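/- Let $d\ge 1$ be an integer, $0<\alpha\le 2$, $0<\beta\le 1$. Let $p_t(x)$, $t>0$, $x\in\mathbb R^d$, be the transition density of the standard (symmetric) $\alpha$-stable Lévy process in $\mathbb R^d$, i.e. $p_t(x)=(2\pi)^{-d}\int_{\mathbb R^d}e^{-i\langle x,y\rangle}e^{-t|y|^\alpha}\,dy$. Put $\psi(z)=|z|^{1+\beta}\bigl(1-i\,\mathrm{sgn}(z)\tan\frac{\pi(1+\beta)}{2}\bigr)$, and let $M$ be an independently scattered, $\sigma$-additive (a.s.) $(1+\beta)$-stable random measure on $\mathbb R\times\mathbb R^d=\mathbb R^{d+1}$ with Lebesgue control measure $\lambda$ and skewness intensity $1$, i.e. $E\,e^{izM(A)}=\exp\{-\lambda(A)\psi(z)\}$ for Borel sets $A$ with $\lambda(A)<\infty$, the values of $M$ on disjoint sets are independent, and $M(\bigcup_j A_j)=\lim_n\sum_{j\le n}M(A_j)$ a.s. for disjoint $A_j$ whose union has finite measure. For $t\ge 0$ consider $$\xi_t=\int_{\mathbb R^{d+1}}\Bigl(\mathbf 1_{[0,t]}(r)\int_r^t p_{u-r}(x)\,du\Bigr)M(dr\,dx),\qquad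 \zeta_t=\int_{\mathbb R^{d+1}}\Bigl(\mathbf 1_{[0,t]}(r)\,p_r^{1/(1+\beta)}(x)\int_r^t p_{u-r}(x)\,du\Bigr)M(dr\,dx).$$ A process $X_t=\int f_t\,dM$, $t\ge 0$, is called well defined if for every $t\ge0$ the integrand $f_t$ makes sense almost everywhere (with finite inner integrals and non-negative bases of powers) and belongs to $L^{1+\beta}(\mathbb R^{d+1})$; there are simple functions $f^{(n)}=\sum_j c_j\mathbf 1_{A_j}$ (finite sums, $A_j$ disjoint, $\lambda(A_j)<\infty$) that converge to $f_t$ a.e. and are dominated in absolute value by one function of $L^{1+\beta}(\mathbb R^{d+1})$; for all such sequences the integrals $\int f^{(n)}\,dM=\sum_j c_jM(A_j)$ converge in probability to one and the same random variable $X_t$, which is thus unique a.s.; and $$E\exp\Bigl\{i\sum_k z_kX_{t_k}\Bigr\}=\exp\Bigl\{-\int_{\mathbb R^{d+1}}\psi\Bigl(\sum_k z_kf_{t_k}(q)\Bigr)dq\Bigr\}$$ for all finite families of distinct times $t_k\ge0$ and of $z_k\in\mathbb R$. Then the process $\xi$ is well defined if $d<\alpha(1+\beta)/\beta$, and the process $\zeta$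 is well defined if $d<\alpha(2+\beta)/(1+\beta)$. -/

import Mathlib

open MeasureTheory ProbabilityTheory Filter Topology

noncomputable section

/-- The function `ψ_a(z) = |z|^a (1 - i sgn(z) tan(π a / 2))`. A stable law of index `a`, unit scale,
skewness one and shift zero has characteristic function `exp(-ψ_a)`. -/
def stableExponent (a z : ℝ) : ℂ :=
  ((|z| ^ a : ℝ) : ℂ) *
    (1 - Complex.I * ((SignType.sign z : ℝ) : ℂ) * ((Real.tan (Real.pi / 2 * a) : ℝ) : ℂ))

/-- `M` is an independently scattered `a`-stable random measure with control measure `m` and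
skewness intensity one. Only the values of `M` on measurable sets of finite `m`-measure matter.
The series in `sigma_additive` is the limit of its partial sums: it need not converge absolutely. -/
structure IsStableRandomMeasure {Ω S : Type*} [MeasurableSpace Ω] [MeasurableSpace S]
    (P : Measure Ω) (m : Measure S) (a : ℝ) (M : Set S → Ω → ℝ) : Prop where
  measurable : ∀ A, MeasurableSet A → m A < ⊤ → Measurable (M A)
  charFun_eq : ∀ A, MeasurableSet A → m A < ⊤ → ∀ z : ℝ,
    charFun (P.map (M A)) z = Complex.exp (-(((m A).toReal : ℝ) : ℂ) * stableExponent a z)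
  independent : ∀ (n : ℕ) (A : Fin n → Set S), (∀ i, MeasurableSet (A i)) → (∀ i, m (A i) < ⊤) →
    Pairwise (fun i j => Disjoint (A i) (A j)) → iIndepFun (fun i => M (A i)) P
  sigma_additive : ∀ A : ℕ → Set S, (∀ i, MeasurableSet (A i)) → m (⋃ i, A i) < ⊤ →
    Pairwise (fun i j => Disjoint (A i) (A j)) →
    ∀ᵐ ω ∂P, Tendsto (fun n => ∑ i ∈ Finset.range n, M (A i) ω) atTop (𝓝 (M (⋃ i, A i) ω))

/-- The integral `∑ c_j M(A_j)` of a simple function `∑ c_j 1_{A_j}` in its canonical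
representation (the value `c = 0` contributes nothing). -/
def simpleStableIntegral {Ω S : Type*} [MeasurableSpace S] (M : Set S → Ω → ℝ)
    (f : SimpleFunc S ℝ) (ω : Ω) : ℝ :=
  ∑ c ∈ f.range, c * M (f ⁻¹' {c}) ω

/-- `F n` is a sequence of simple functions, supported on sets of finite measure, which
converges to `f` almost everywhere and is dominated by a function in `L^a(m)`. -/
structure IsSimpleApprox {S : Type*} [MeasurableSpace S] (m : Measure S) (a : ℝ)
    (f : S → ℝ) (F : ℕ → SimpleFunc S ℝ) : Prop where
  finMeasSupp : ∀ n, (F n).FinMeasSupp m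
  dominated : ∃ g : S → ℝ, MemLp g (ENNReal.ofReal a) m ∧ ∀ n, ∀ᵐ x ∂m, |F n x| ≤ g x
  tendsto_ae : ∀ᵐ x ∂m, Tendsto (fun n => F n x) atTop (𝓝 (f x))

/-- The random variable `Y` is the stable stochastic integral `∫ f dM`: approximating sequences
of simple functions exist, and along each of them the integrals converge to `Y` in probability. -/
structure IsStableIntegral {Ω S : Type*} [MeasurableSpace Ω] [MeasurableSpace S]
    (P : Measure Ω) (m : Measure S) (a : ℝ) (M : Set S → Ω → ℝ) (f : S → ℝ) (Y : Ω → ℝ) :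
    Prop where
  measurable : Measurable Y
  exists_approx : ∃ F, IsSimpleApprox m a f F
  tendsto : ∀ F, IsSimpleApprox m a f F →
    TendstoInMeasure P (fun n => simpleStableIntegral M (F n)) atTop Y

/-- The process `X_t = ∫ f_t dM`, `t ≥ 0`, is well defined: every `f_t` lies in `L^a(m)`, the
integrals exist and are unique almost surely, and the process has the finite-dimensional
distributions `E exp(i ∑ z_k X_{t_k}) = exp(-∫ ψ_a(∑ z_k f_{t_k}) dm)`. -/
def StableIntegralProcessWellDefined {Ω S : Type*} [MeasurableSpace Ω] [MeasurableSpace S]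
    (P : Measure Ω) (m : Measure S) (a : ℝ) (M : Set S → Ω → ℝ) (f : ℝ → S → ℝ) : Prop :=
  (∀ t : ℝ, 0 ≤ t → MemLp (f t) (ENNReal.ofReal a) m) ∧
  ∃ X : ℝ → Ω → ℝ,
    (∀ t : ℝ, 0 ≤ t → IsStableIntegral P m a M (f t) (X t)) ∧
    (∀ X' : ℝ → Ω → ℝ, (∀ t : ℝ, 0 ≤ t → IsStableIntegral P m a M (f t) (X' t)) →
      ∀ t : ℝ, 0 ≤ t → X' t =ᵐ[P] X t) ∧
    (∀ (T : Finset ℝ) (z : ℝ → ℝ), (∀ t ∈ T, 0 ≤ t) →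
      ∫ ω, Complex.exp (Complex.I * ((∑ t ∈ T, z t * X t ω : ℝ) : ℂ)) ∂P =
        Complex.exp (-∫ q, stableExponent a (∑ t ∈ T, z t * f t q) ∂m))

/-- The transition density `p_t(x)` (`t > 0`) of the standard (rotationally symmetric) `α`-stable
Lévy process in `ℝ^d`, whose characteristic function at time `t` is `exp(-t |y|^α)`, given by
Fourier inversion. -/
def stableDensity (d : ℕ) (α t : ℝ) (x : EuclideanSpace ℝ (Fin d)) : ℝ :=
  (((2 * Real.pi) ^ d)⁻¹ : ℝ) *
    (∫ y : EuclideanSpace ℝ (Fin d),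
      Complex.exp (-(Complex.I * ((inner ℝ x y : ℝ) : ℂ))) *
        ((Real.exp (-(t * ‖y‖ ^ α)) : ℝ) : ℂ)).re

/-- `(r, x) ↦ 1_{[0,t]}(r) ∫_r^t p_{u-r}(x) du`. -/
def xiKernel (d : ℕ) (α t : ℝ) (q : ℝ × EuclideanSpace ℝ (Fin d)) : ℝ :=
  (Set.Icc 0 t).indicator (fun r => ∫ u in r..t, stableDensity d α (u - r) q.2) q.1

/-- `(r, x) ↦ 1_{[0,t]}(r) p_r(x)^{1/(1+β)} ∫_r^t p_{u-r}(x) du`. -/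
def zetaKernel (d : ℕ) (α β t : ℝ) (q : ℝ × EuclideanSpace ℝ (Fin d)) : ℝ :=
  (Set.Icc 0 t).indicator
    (fun r => stableDensity d α r q.2 ^ (1 / (1 + β)) *
      ∫ u in r..t, stableDensity d α (u - r) q.2) q.1

end

/-!
Along an approximating sequence `F_n`, the integral of `F_n - F_k` has characteristic function
`exp(-∫ ψ_a(z (F_n - F_k)) dm)`, which tends to `1` by dominated convergence. So the integrals are
Cauchy in probability, and every `f ∈ L^a(m)` has a stable integral. It remains to place the kernels
in `L^a` for `a = 1 + β`.

Since `s ↦ s^(α/2)` is a Bernstein function, `exp(-t |y|^α)` is a limit of exponentials of mixtures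
of resolvents `(u + |y|²)⁻¹`, hence positive definite: `p_t ≥ 0`, and `p_t` has mass at most one.
Together with `p_t ≤ C t^(-d/α)` this gives `∫ p_u^b dx ≲ u^(-(b-1)d/α)`. By Hölder's inequality
in time the occupation density `∫_0^t p_u du` lies in `L^b` as soon as `(b - 1) d / α < b`.

On `0 ≤ r ≤ t` the inner integral of both kernels is at most the occupation density, which does not
depend on `r`. The factor `p_r^(1/a)` of `ζ` contributes, after integrating its `a`-th power over
`r`, one more occupation density. So `ξ` needs `b = a` and `ζ` needs `b = 1 + a`.
-/

noncomputable section

section ConvergenceInMeasure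

variable {Ω ι E : Type*} [MeasurableSpace Ω] {P : Measure Ω} [NormedAddCommGroup E]

theorem tendstoInMeasure_add {l : Filter ι} {U V : ι → Ω → E} {X Y : Ω → E}
    (hU : TendstoInMeasure P U l X) (hV : TendstoInMeasure P V l Y) :
    TendstoInMeasure P (fun i => U i + V i) l (X + Y) := by
  rw [tendstoInMeasure_iff_norm] at hU hV ⊢
  intro ε hε
  refine tendsto_of_tendsto_of_tendsto_of_le_of_le tendsto_const_nhds
    (by simpa using (hU _ (half_pos hε)).add (hV _ (half_pos hε))) (fun _ => zero_le) fun i => ?_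
  refine (measure_mono fun ω hω => ?_).trans (measure_union_le _ _)
  by_contra h
  simp only [Set.mem_union, Set.mem_ofPred_eq, not_or, not_le, Pi.add_apply] at h hω
  rw [add_sub_add_comm] at hω
  linarith [norm_add_le (U i ω - X ω) (V i ω - Y ω)]

theorem tendstoInMeasure_const_smul [NormedSpace ℝ E] {l : Filter ι} {U : ι → Ω → E} {X : Ω → E}
    (c : ℝ) (hU : TendstoInMeasure P U l X) :
    TendstoInMeasure P (fun i => c • U i) l (c • X) := by
  rw [tendstoInMeasure_iff_norm] at hU ⊢
  intro ε hε
  rcases eq_or_ne c 0 with rfl | hc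
  · simpa [hε.not_ge] using tendsto_const_nhds
  · have hc' : 0 < ‖c‖ := norm_pos_iff.2 hc
    simpa only [Pi.smul_apply, ← smul_sub, norm_smul, div_le_iff₀' hc'] using
      hU _ (div_pos hε hc')

theorem exists_strictMono_measure_lt_of_cauchy {U : ℕ → Ω → E}
    (h : TendstoInMeasure P (fun (p : ℕ × ℕ) => U p.1 - U p.2) (atTop ×ˢ atTop) 0) :
    ∃ φ : ℕ → ℕ, StrictMono φ ∧ ∀ n,
      P {ω | (1 / 2 : ℝ) ^ n ≤ ‖U (φ (n + 1)) ω - U (φ n) ω‖} ≤ (1 / 2) ^ n := by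
  rw [tendstoInMeasure_iff_norm, prod_atTop_atTop_eq] at h
  obtain ⟨φ, hφ, hP⟩ := extraction_forall_of_eventually
    (P := fun n k => ∀ i ≥ k, ∀ j ≥ k,
      P {ω | (1 / 2 : ℝ) ^ n ≤ ‖U i ω - U j ω‖} ≤ (1 / 2) ^ n) fun n => by
    obtain ⟨k, hk⟩ := eventually_atTop.1 <|
      (h ((1 / 2) ^ n) (by positivity)).eventually_le_const
        (ENNReal.pow_pos (by simp : (0 : ENNReal) < 1 / 2) n)
    filter_upwards [eventually_ge_atTop (max k.1 k.2)] with m hm i hi j hj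
    simpa using hk (i, j) ⟨(le_max_left _ _).trans (hm.trans hi),
      (le_max_right _ _).trans (hm.trans hj)⟩
  exact ⟨φ, hφ, fun n => hP n _ (hφ.monotone n.le_succ) _ le_rfl⟩

theorem ae_cauchySeq_of_measure_le [CompleteSpace E] {U : ℕ → Ω → E}
    (h : ∀ n, P {ω | (1 / 2 : ℝ) ^ n ≤ ‖U (n + 1) ω - U n ω‖} ≤ (1 / 2) ^ n) :
    ∀ᵐ ω ∂P, CauchySeq fun n => U n ω := by
  have hsum : ∑' n, P {ω | (1 / 2 : ℝ) ^ n ≤ ‖U (n + 1) ω - U n ω‖} ≠ ⊤ := by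
    refine ne_top_of_le_ne_top ?_ (ENNReal.tsum_le_tsum h)
    rw [ENNReal.tsum_geometric]
    simp
  filter_upwards [ae_eventually_notMem hsum] with ω hω
  obtain ⟨N, hN⟩ := eventually_atTop.1 hω
  refine (cauchySeq_shift N).1 (cauchySeq_of_le_geometric (1 / 2) 1 (by norm_num) fun n => ?_)
  rw [dist_comm, dist_eq_norm, one_mul, Nat.add_right_comm]
  exact (not_le.1 (hN (n + N) (Nat.le_add_left _ _))).le.trans
    (pow_le_pow_of_le_one (by norm_num) (by norm_num) (Nat.le_add_right _ _))

theorem exists_tendstoInMeasure_of_cauchy [IsFiniteMeasure P] [CompleteSpace E]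
    {U : ℕ → Ω → E} (hU : ∀ n, AEStronglyMeasurable (U n) P)
    (h : TendstoInMeasure P (fun (p : ℕ × ℕ) => U p.1 - U p.2) (atTop ×ˢ atTop) 0) :
    ∃ Y : Ω → E, StronglyMeasurable Y ∧ TendstoInMeasure P U atTop Y := by
  obtain ⟨φ, hφ, hP⟩ := exists_strictMono_measure_lt_of_cauchy h
  obtain ⟨Y, hY, hlim⟩ := exists_stronglyMeasurable_limit_of_tendsto_ae (fun n => hU (φ n))
    ((ae_cauchySeq_of_measure_le hP).mono fun _ => cauchySeq_tendsto_of_complete)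
  refine ⟨Y, hY, ?_⟩
  have hdiff := h.comp (ns := fun n => (n, φ n)) (tendsto_id.prodMk hφ.tendsto_atTop)
  simpa using tendstoInMeasure_add hdiff
    (tendstoInMeasure_of_tendsto_ae (fun n => hU (φ n)) hlim)

theorem tendstoInMeasure_zero_of_tendsto_charFun [IsProbabilityMeasure P]
    [InnerProductSpace ℝ E] [FiniteDimensional ℝ E] [MeasurableSpace E] [BorelSpace E]
    {l : Filter ι} [l.IsCountablyGenerated] {U : ι → Ω → E} (hU : ∀ i, Measurable (U i))
    (h : ∀ z, Tendsto (fun i => charFun (P.map (U i)) z) l (𝓝 1)) :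
    TendstoInMeasure P U l 0 := by
  rw [tendstoInMeasure_iff_norm]
  intro ε hε
  refine tendsto_of_seq_tendsto fun s hs => ?_
  let μ : ℕ → ProbabilityMeasure E := fun n =>
    ⟨P.map (U (s n)), Measure.isProbabilityMeasure_map (hU _).aemeasurable⟩
  let δ : ProbabilityMeasure E := ⟨Measure.dirac 0, inferInstance⟩
  have hμ : Tendsto μ atTop (𝓝 δ) := ProbabilityMeasure.tendsto_of_tendsto_charFun fun z => by
    simpa [δ, μ, charFun_dirac, Function.comp_def] using (h z).comp hs
  have hF : IsClosed {x : E | ε ≤ ‖x‖} := isClosed_le continuous_const continuous_norm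
  have hlim := ProbabilityMeasure.limsup_measure_closed_le_of_tendsto hμ hF
  have hδ : (δ : Measure E) {x : E | ε ≤ ‖x‖} = 0 := by
    simp [δ, hε, hF.measurableSet]
  refine tendsto_of_le_liminf_of_limsup_le zero_le ?_
  simpa [hδ, μ, Measure.map_apply (hU _) hF.measurableSet, Function.comp_def] using hlim

end ConvergenceInMeasure

section StableExponent

theorem stableExponent_zero {a : ℝ} (ha : a ≠ 0) : stableExponent a 0 = 0 := by
  simp [stableExponent, Real.zero_rpow ha]

theorem norm_stableExponent_le (a z : ℝ) :
    ‖stableExponent a z‖ ≤ (1 + |Real.tan (Real.pi / 2 * a)|) * |z| ^ a := by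
  have hsign : |((SignType.sign z : SignType) : ℝ)| ≤ 1 := by
    rcases lt_trichotomy z 0 with h | h | h <;> simp [h]
  rw [stableExponent, norm_mul, Complex.norm_real, Real.norm_of_nonneg (by positivity), mul_comm]
  gcongr
  refine (norm_sub_le _ _).trans ?_
  simp only [norm_one, norm_mul, Complex.norm_I, one_mul, Complex.norm_real, Real.norm_eq_abs]
  gcongr
  exact mul_le_of_le_one_left (abs_nonneg _) hsign

theorem continuous_stableExponent {a : ℝ} (ha : 0 < a) : Continuous (stableExponent a) := by
  have h : stableExponent a = fun z : ℝ => ((|z| ^ a : ℝ) : ℂ) - Complex.I *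
      ((max z 0 ^ a - max (-z) 0 ^ a : ℝ) : ℂ) * ((Real.tan (Real.pi / 2 * a) : ℝ) : ℂ) := by
    ext z
    rcases lt_trichotomy z 0 with hz | rfl | hz
    · simp only [stableExponent, abs_of_neg hz, sign_neg hz, max_eq_right hz.le,
        max_eq_left (neg_nonneg.2 hz.le), Real.zero_rpow ha.ne', SignType.coe_neg, SignType.coe_one]
      push_cast
      ring
    · simp [stableExponent, Real.zero_rpow ha.ne']
    · simp only [stableExponent, abs_of_pos hz, sign_pos hz, max_eq_left hz.le,
        max_eq_right (neg_nonpos.2 hz.le), Real.zero_rpow ha.ne', SignType.coe_one]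
      push_cast
      ring
  have hpow : Continuous fun z : ℝ => max z 0 ^ a :=
    (continuous_id.max continuous_const).rpow_const fun _ => Or.inr ha.le
  have habs : Continuous fun z : ℝ => |z| ^ a :=
    continuous_abs.rpow_const fun _ => Or.inr ha.le
  have hpow' : Continuous fun z : ℝ => max (-z) 0 ^ a := hpow.comp continuous_neg
  rw [h]
  fun_prop

end StableExponent

section SimpleIntegral

variable {Ω S : Type*} [MeasurableSpace Ω] [MeasurableSpace S] {P : Measure Ω}
  {m : Measure S} {a : ℝ} {M : Set S → Ω → ℝ}

namespace IsStableRandomMeasure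

theorem ae_empty (hM : IsStableRandomMeasure P m a M) : ∀ᵐ ω ∂P, M ∅ ω = 0 := by
  filter_upwards [hM.sigma_additive (fun _ => ∅) (by simp) (by simp) (fun i j _ => by simp)]
    with ω hω
  simp only [Finset.sum_const, Finset.card_range, nsmul_eq_mul, Set.iUnion_empty] at hω
  by_contra h0
  refine not_tendsto_nhds_of_tendsto_atTop tendsto_natCast_atTop_atTop (1 : ℝ) ?_
  simpa [h0] using hω.div_const (M ∅ ω)

theorem ae_iUnion (hM : IsStableRandomMeasure P m a M) {ι : Type*} [Fintype ι] {A : ι → Set S}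
    (hA : ∀ i, MeasurableSet (A i)) (hmA : ∀ i, m (A i) < ⊤)
    (hd : Pairwise fun i j => Disjoint (A i) (A j)) :
    ∀ᵐ ω ∂P, M (⋃ i, A i) ω = ∑ i, M (A i) ω := by
  let e : ι → ℕ := fun i => Fintype.equivFin ι i
  have he : e.Injective := Fin.val_injective.comp (Fintype.equivFin ι).injective
  let C : ℕ → Set S := fun n => ⋃ (i) (_ : e i = n), A i
  have hC : ⋃ n, C n = ⋃ i, A i := by ext; simp [C]
  have hCe : ∀ i, C (e i) = A i := fun i => by simp [C, he.eq_iff]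
  have hCd : Pairwise fun n k => Disjoint (C n) (C k) := by
    intro n k hnk
    simp only [C, Set.disjoint_iUnion_left, Set.disjoint_iUnion_right]
    rintro i rfl j rfl
    exact hd (by rintro rfl; exact hnk rfl)
  have hσ := hM.sigma_additive C
    (fun n => .iUnion fun i => .iUnion fun _ => hA i)
    (by rw [hC]; exact (measure_iUnion_fintype_le m A).trans_lt (ENNReal.sum_lt_top.2
      fun i _ => hmA i)) hCd
  filter_upwards [hσ, hM.ae_empty] with ω hω h0
  have hsum : HasSum (fun n => M (C n) ω) (∑ i, M (A i) ω) := by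
    refine (he.hasSum_iff fun n hn => ?_).1 ?_
    · have : C n = ∅ := by simpa [C] using fun i hi => absurd ⟨i, hi⟩ hn
      rw [this, h0]
    · simpa only [Function.comp_def, hCe] using hasSum_fintype fun i => M (A i) ω
  rw [← hC]
  exact tendsto_nhds_unique hω hsum.tendsto_sum_nat

theorem iIndepFun (hM : IsStableRandomMeasure P m a M) {ι : Type*} [Finite ι] {A : ι → Set S}
    (hA : ∀ i, MeasurableSet (A i)) (hmA : ∀ i, m (A i) < ⊤)
    (hd : Pairwise fun i j => Disjoint (A i) (A j)) : iIndepFun (fun i => M (A i)) P := by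
  let e := Finite.equivFin ι
  have h := hM.independent _ (A ∘ e.symm) (fun _ => hA _) (fun _ => hmA _)
    fun i j hij => hd (e.symm.injective.ne hij)
  simpa using h.precomp e.injective

theorem charFun_sum (hM : IsStableRandomMeasure P m a M) {ι : Type*} [Fintype ι] {A : ι → Set S}
    (hA : ∀ i, MeasurableSet (A i)) (hmA : ∀ i, m (A i) < ⊤)
    (hd : Pairwise fun i j => Disjoint (A i) (A j)) (c : ι → ℝ) (z : ℝ) :
    charFun (P.map fun ω => ∑ i, c i * M (A i) ω) z =
      Complex.exp (-∑ i, m.real (A i) • stableExponent a (z * c i)) := by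
  have hmeas : ∀ i, Measurable (M (A i)) := fun i => hM.measurable _ (hA i) (hmA i)
  have hind := (hM.iIndepFun hA hmA hd).comp (fun i x => c i * x) fun _ => measurable_const_mul _
  have hterm : ∀ i, charFun (P.map fun ω => c i * M (A i) ω) z =
      Complex.exp (-(m.real (A i) • stableExponent a (z * c i))) := by
    intro i
    have hmap : (P.map fun ω => c i * M (A i) ω) = (P.map (M (A i))).map (c i * ·) :=
      (Measure.map_map (measurable_const_mul _) (hmeas i)).symm
    rw [hmap, charFun_map_mul, hM.charFun_eq _ (hA i) (hmA i), mul_comm (c i), Complex.real_smul,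
      neg_mul, Measure.real]
  have hprod := iIndepFun.charFun_map_fun_sum_eq_prod
    (fun i => ((hmeas i).const_mul (c i)).aemeasurable) hind
  rw [← Finset.sum_neg_distrib, Complex.exp_sum]
  exact (congr_fun hprod z).trans ((Finset.prod_apply _ _ _).trans
    (Finset.prod_congr rfl fun i _ => hterm i))

end IsStableRandomMeasure

theorem measurable_simpleStableIntegral (hM : IsStableRandomMeasure P m a M)
    {F : SimpleFunc S ℝ} (hF : F.FinMeasSupp m) : Measurable (simpleStableIntegral M F) := by
  refine Finset.measurable_fun_sum _ fun c _ => ?_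
  rcases eq_or_ne c 0 with rfl | hc
  · simp
  · exact (hM.measurable _ (F.measurableSet_preimage _)
      (SimpleFunc.finMeasSupp_iff.1 hF c hc)).const_mul c

theorem simpleStableIntegral_map (hM : IsStableRandomMeasure P m a M) {γ : Type*}
    (G : SimpleFunc S γ) (φ : γ → ℝ) (hG : ∀ g, φ g ≠ 0 → m (G ⁻¹' {g}) < ⊤) :
    ∀ᵐ ω ∂P, simpleStableIntegral M (G.map φ) ω = ∑ g ∈ G.range, φ g * M (G ⁻¹' {g}) ω := by
  classical
  have hfiber : ∀ c ∈ (G.map φ).range, ∀ᵐ ω ∂P,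
      c * M (G.map φ ⁻¹' {c}) ω = ∑ g ∈ G.range with φ g = c, φ g * M (G ⁻¹' {g}) ω := by
    intro c _
    rcases eq_or_ne c 0 with rfl | hc
    · refine Eventually.of_forall fun ω => ?_
      rw [zero_mul, Finset.sum_eq_zero fun g hg => by rw [(Finset.mem_filter.1 hg).2, zero_mul]]
    · have hadd := hM.ae_iUnion (A := fun g : {g ∈ G.range | φ g = c} => G ⁻¹' {(g : γ)})
        (fun g => G.measurableSet_preimage _)
        (fun g => hG g (by rw [(Finset.mem_filter.1 g.2).2]; exact hc))
        fun g g' hgg =>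
          Disjoint.preimage _ (Set.disjoint_singleton.2 (Subtype.coe_injective.ne hgg))
      have hunion : ⋃ g : {g ∈ G.range | φ g = c}, G ⁻¹' {(g : γ)} = G.map φ ⁻¹' {c} := by
        ext x
        simp
      filter_upwards [hadd] with ω hω
      rw [← hunion, hω, Finset.mul_sum, Finset.sum_coe_sort _ fun g => c * M (G ⁻¹' {g}) ω]
      exact Finset.sum_congr rfl fun g hg => by rw [(Finset.mem_filter.1 hg).2]
  filter_upwards [(Finset.eventually_all _).2 hfiber] with ω hω
  rw [simpleStableIntegral, Finset.sum_congr rfl hω]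
  refine Finset.sum_fiberwise_of_maps_to (fun g hg => ?_) _
  rw [SimpleFunc.range_map]
  exact Finset.mem_image_of_mem _ hg

theorem simpleStableIntegral_smul_add_smul (hM : IsStableRandomMeasure P m a M)
    {F G : SimpleFunc S ℝ} (hF : F.FinMeasSupp m) (hG : G.FinMeasSupp m) (u v : ℝ) :
    simpleStableIntegral M (u • F + v • G) =ᵐ[P]
      u • simpleStableIntegral M F + v • simpleStableIntegral M G := by
  have hfin : ∀ φ : ℝ × ℝ → ℝ, φ 0 = 0 → ∀ g, φ g ≠ 0 → m (F.pair G ⁻¹' {g}) < ⊤ :=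
    fun φ h0 g hg => SimpleFunc.finMeasSupp_iff.1 (hF.pair hG) g (by rintro rfl; exact hg h0)
  have hsum : u • F + v • G = (F.pair G).map fun p => u * p.1 + v * p.2 := rfl
  filter_upwards [simpleStableIntegral_map hM (F.pair G) (fun p => u * p.1 + v * p.2)
      (hfin _ (by simp)), simpleStableIntegral_map hM (F.pair G) Prod.fst (hfin _ rfl),
      simpleStableIntegral_map hM (F.pair G) Prod.snd (hfin _ rfl)] with ω hω hω₁ hω₂
  rw [SimpleFunc.map_fst_pair] at hω₁
  rw [SimpleFunc.map_snd_pair] at hω₂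
  simp only [hsum, hω, hω₁, hω₂, Pi.add_apply, Pi.smul_apply, smul_eq_mul, Finset.mul_sum,
    ← Finset.sum_add_distrib]
  exact Finset.sum_congr rfl fun _ _ => by ring

theorem integral_comp_simpleFunc {F : SimpleFunc S ℝ} (hF : F.FinMeasSupp m) {ψ : ℝ → ℂ}
    (hψ : ψ 0 = 0) : ∫ x, ψ (F x) ∂m = ∑ c ∈ F.range.erase 0, m.real (F ⁻¹' {c}) • ψ c := by
  have hmap := SimpleFunc.map_integral F ψ (SimpleFunc.integrable_iff_finMeasSupp.2 hF) hψ
  rw [SimpleFunc.integral_eq_integral _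
    (SimpleFunc.integrable_iff_finMeasSupp.2 (hF.map hψ))] at hmap
  rw [Finset.sum_erase _ (by rw [hψ, smul_zero]), ← hmap]
  rfl

theorem charFun_simpleStableIntegral (ha : 0 < a) (hM : IsStableRandomMeasure P m a M)
    {F : SimpleFunc S ℝ} (hF : F.FinMeasSupp m) (z : ℝ) :
    charFun (P.map (simpleStableIntegral M F)) z =
      Complex.exp (-∫ x, stableExponent a (z * F x) ∂m) := by
  have hI : simpleStableIntegral M F =
      fun ω => ∑ c : F.range.erase 0, (c : ℝ) * M (F ⁻¹' {(c : ℝ)}) ω := by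
    ext ω
    rw [Finset.sum_coe_sort _ fun c : ℝ => c * M (F ⁻¹' {c}) ω, Finset.sum_erase _ (by simp),
      simpleStableIntegral]
  rw [hI, hM.charFun_sum (fun _ => F.measurableSet_preimage _)
    (fun c => SimpleFunc.finMeasSupp_iff.1 hF _ (Finset.mem_erase.1 c.2).1)
    (fun c c' h => Disjoint.preimage _ (Set.disjoint_singleton.2 (Subtype.coe_injective.ne h)))
    _ z, Finset.sum_coe_sort _ fun c => m.real (F ⁻¹' {c}) • stableExponent a (z * c),
    integral_comp_simpleFunc hF (ψ := fun c => stableExponent a (z * c))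
      (by rw [mul_zero, stableExponent_zero ha.ne'])]

end SimpleIntegral

section StableIntegral

variable {Ω S : Type*} [MeasurableSpace Ω] [MeasurableSpace S] {P : Measure Ω}
  {m : Measure S} {a : ℝ} {M : Set S → Ω → ℝ}

theorem tendsto_integral_stableExponent (ha : 0 < a) {ι : Type*} {l : Filter ι}
    [l.IsCountablyGenerated] {F : ι → S → ℝ} {f g : S → ℝ}
    (hF : ∀ i, AEStronglyMeasurable (F i) m) (hg : MemLp g (ENNReal.ofReal a) m)
    (hFg : ∀ i, ∀ᵐ x ∂m, |F i x| ≤ g x)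
    (hlim : ∀ᵐ x ∂m, Tendsto (fun i => F i x) l (𝓝 (f x))) :
    Tendsto (fun i => ∫ x, stableExponent a (F i x) ∂m) l
      (𝓝 (∫ x, stableExponent a (f x) ∂m)) := by
  have hint := hg.integrable_norm_rpow (by simpa using ha) (by simp)
  rw [ENNReal.toReal_ofReal ha.le] at hint
  refine tendsto_integral_filter_of_dominated_convergence
    (fun x => (1 + |Real.tan (Real.pi / 2 * a)|) * ‖g x‖ ^ a)
    (.of_forall fun i => (continuous_stableExponent ha).comp_aestronglyMeasurable (hF i))
    (.of_forall fun i => ?_) (hint.const_mul _) ?_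
  · filter_upwards [hFg i] with x hx
    have hxg : |F i x| ≤ ‖g x‖ := hx.trans (le_abs_self _)
    exact (norm_stableExponent_le _ _).trans (by gcongr)
  · filter_upwards [hlim] with x hx
    exact ((continuous_stableExponent ha).tendsto _).comp hx

theorem tendsto_charFun_simpleStableIntegral (ha : 0 < a) (hM : IsStableRandomMeasure P m a M)
    {ι : Type*} {l : Filter ι} [l.IsCountablyGenerated] {F : ι → SimpleFunc S ℝ} {f g : S → ℝ}
    (hF : ∀ i, (F i).FinMeasSupp m) (hg : MemLp g (ENNReal.ofReal a) m)
    (hFg : ∀ i, ∀ᵐ x ∂m, |F i x| ≤ g x)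
    (hlim : ∀ᵐ x ∂m, Tendsto (fun i => F i x) l (𝓝 (f x))) (z : ℝ) :
    Tendsto (fun i => charFun (P.map (simpleStableIntegral M (F i))) z) l
      (𝓝 (Complex.exp (-∫ x, stableExponent a (z * f x) ∂m))) := by
  simp_rw [fun i => charFun_simpleStableIntegral ha hM (hF i) z]
  refine (Complex.continuous_exp.tendsto _).comp (tendsto_integral_stableExponent ha
    (fun i => (F i).aestronglyMeasurable.const_mul z) (hg.const_mul |z|) (fun i => ?_) ?_).neg
  · filter_upwards [hFg i] with x hx
    rw [abs_mul]
    gcongr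
  · filter_upwards [hlim] with x hx using hx.const_mul z

namespace IsSimpleApprox

variable {f g : S → ℝ} {F G : ℕ → SimpleFunc S ℝ}

theorem smul_add_smul (hF : IsSimpleApprox m a f F) (hG : IsSimpleApprox m a g G) (u v : ℝ) :
    IsSimpleApprox m a (u • f + v • g) (fun n => u • F n + v • G n) where
  finMeasSupp n := ((hF.finMeasSupp n).map (mul_zero u)).add ((hG.finMeasSupp n).map (mul_zero v))
  dominated := by
    obtain ⟨b, hb, hFb⟩ := hF.dominated
    obtain ⟨c, hc, hGc⟩ := hG.dominated
    refine ⟨_, (hb.const_mul |u|).add (hc.const_mul |v|), fun n => ?_⟩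
    filter_upwards [hFb n, hGc n] with x hFx hGx
    calc |(u • F n + v • G n) x| ≤ |u| * |F n x| + |v| * |G n x| := by
          simpa [abs_mul] using abs_add_le (u * F n x) (v * G n x)
      _ ≤ |u| * b x + |v| * c x := by gcongr
  tendsto_ae := by
    filter_upwards [hF.tendsto_ae, hG.tendsto_ae] with x hFx hGx
    exact (hFx.const_mul u).add (hGx.const_mul v)

theorem tendstoInMeasure_sub [IsProbabilityMeasure P] (ha : 0 < a)
    (hM : IsStableRandomMeasure P m a M) (hF : IsSimpleApprox m a f F)
    (hG : IsSimpleApprox m a f G) :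
    TendstoInMeasure P (fun (p : ℕ × ℕ) =>
      simpleStableIntegral M (F p.1) - simpleStableIntegral M (G p.2)) (atTop ×ˢ atTop) 0 := by
  let H : ℕ × ℕ → SimpleFunc S ℝ := fun p => (1 : ℝ) • F p.1 + (-1 : ℝ) • G p.2
  have hH : ∀ p, (H p).FinMeasSupp m := fun p =>
    ((hF.finMeasSupp p.1).map (mul_zero 1)).add ((hG.finMeasSupp p.2).map (mul_zero (-1)))
  have hsub : ∀ p, simpleStableIntegral M (H p) =ᵐ[P]
      simpleStableIntegral M (F p.1) - simpleStableIntegral M (G p.2) := fun p => by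
    simpa [H, sub_eq_add_neg] using
      simpleStableIntegral_smul_add_smul hM (hF.finMeasSupp p.1) (hG.finMeasSupp p.2) 1 (-1)
  obtain ⟨b, hb, hFb⟩ := hF.dominated
  obtain ⟨c, hc, hGc⟩ := hG.dominated
  have hHbc : ∀ p, ∀ᵐ x ∂m, |H p x| ≤ b x + c x := fun p => by
    filter_upwards [hFb p.1, hGc p.2] with x hFx hGx
    calc |H p x| ≤ |F p.1 x| + |G p.2 x| := by
          simpa [H, sub_eq_add_neg] using abs_sub (F p.1 x) (G p.2 x)
      _ ≤ b x + c x := add_le_add hFx hGx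
  have hlim : ∀ᵐ x ∂m, Tendsto (fun p => H p x) (atTop ×ˢ atTop) (𝓝 0) := by
    filter_upwards [hF.tendsto_ae, hG.tendsto_ae] with x hFx hGx
    simpa [H, Function.comp_def, sub_eq_add_neg] using
      (hFx.comp tendsto_fst).sub (hGx.comp tendsto_snd)
  refine TendstoInMeasure.congr_left hsub (tendstoInMeasure_zero_of_tendsto_charFun
    (fun p => measurable_simpleStableIntegral hM (hH p)) fun z => ?_)
  simpa [stableExponent_zero ha.ne'] using
    tendsto_charFun_simpleStableIntegral ha hM hH (hb.add hc) hHbc hlim z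

end IsSimpleApprox

theorem exists_isSimpleApprox (ha : 0 < a) {f : S → ℝ} (hf : MemLp f (ENNReal.ofReal a) m) :
    ∃ F, IsSimpleApprox m a f F := by
  have hm := hf.1.stronglyMeasurable_mk.measurable
  have hf' : MemLp (hf.1.mk f) (ENNReal.ofReal a) m := (memLp_congr_ae hf.1.ae_eq_mk).1 hf
  have h0 : (0 : ℝ) ∈ Set.univ := Set.mem_univ _
  refine ⟨SimpleFunc.approxOn (hf.1.mk f) hm Set.univ 0 h0, fun n => ?_, ?_, ?_⟩
  · exact (SimpleFunc.memLp_iff_finMeasSupp (by simpa using ha) (by simp)).1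
      (SimpleFunc.memLp_approxOn hm hf' h0 MemLp.zero n)
  · exact ⟨fun x => ‖hf.1.mk f x‖ + ‖hf.1.mk f x‖, hf'.norm.add hf'.norm,
      fun n => .of_forall fun x => SimpleFunc.norm_approxOn_zero_le hm h0 x n⟩
  · filter_upwards [hf.1.ae_eq_mk] with x hx
    rw [hx]
    exact SimpleFunc.tendsto_approxOn hm h0 (by simp)

theorem IsStableIntegral.ae_eq {f : S → ℝ} {X Y : Ω → ℝ}
    (hX : IsStableIntegral P m a M f X) (hY : IsStableIntegral P m a M f Y) : X =ᵐ[P] Y := by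
  obtain ⟨F, hF⟩ := hX.exists_approx
  exact tendstoInMeasure_ae_unique (hX.tendsto F hF) (hY.tendsto F hF)

variable [IsProbabilityMeasure P]

namespace IsStableIntegral

variable {f g : S → ℝ} {X Y : Ω → ℝ}

theorem of_isSimpleApprox (ha : 0 < a) (hM : IsStableRandomMeasure P m a M) (hY : Measurable Y)
    {F : ℕ → SimpleFunc S ℝ} (hF : IsSimpleApprox m a f F)
    (h : TendstoInMeasure P (fun n => simpleStableIntegral M (F n)) atTop Y) :
    IsStableIntegral P m a M f Y where
  measurable := hY
  exists_approx := ⟨F, hF⟩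
  tendsto G hG := by
    have hsub := (hG.tendstoInMeasure_sub ha hM hF).comp (ns := fun n => (n, n))
      (tendsto_id.prodMk tendsto_id)
    simpa using tendstoInMeasure_add hsub h

theorem smul_add_smul (ha : 0 < a) (hM : IsStableRandomMeasure P m a M)
    (hX : IsStableIntegral P m a M f X) (hY : IsStableIntegral P m a M g Y) (u v : ℝ) :
    IsStableIntegral P m a M (u • f + v • g) (u • X + v • Y) := by
  obtain ⟨F, hF⟩ := hX.exists_approx
  obtain ⟨G, hG⟩ := hY.exists_approx
  refine of_isSimpleApprox ha hM ((hX.measurable.const_smul u).add (hY.measurable.const_smul v))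
    (hF.smul_add_smul hG u v) (TendstoInMeasure.congr_left (fun n =>
      (simpleStableIntegral_smul_add_smul hM (hF.finMeasSupp n) (hG.finMeasSupp n) u v).symm) ?_)
  exact tendstoInMeasure_add (tendstoInMeasure_const_smul u (hX.tendsto F hF))
    (tendstoInMeasure_const_smul v (hY.tendsto G hG))

theorem charFun_eq (ha : 0 < a) (hM : IsStableRandomMeasure P m a M)
    (hX : IsStableIntegral P m a M f X) (z : ℝ) :
    charFun (P.map X) z = Complex.exp (-∫ q, stableExponent a (z * f q) ∂m) := by
  obtain ⟨F, hF⟩ := hX.exists_approx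
  obtain ⟨g, hg, hFg⟩ := hF.dominated
  have hdist := (hX.tendsto F hF).tendstoInDistribution
    fun n => (measurable_simpleStableIntegral hM (hF.finMeasSupp n)).aemeasurable
  exact tendsto_nhds_unique (ProbabilityMeasure.tendsto_iff_tendsto_charFun.1 hdist.tendsto z)
    (tendsto_charFun_simpleStableIntegral ha hM hF.finMeasSupp hg hFg hF.tendsto_ae z)

theorem integral_exp (ha : 0 < a) (hM : IsStableRandomMeasure P m a M)
    (hX : IsStableIntegral P m a M f X) :
    ∫ ω, Complex.exp (Complex.I * (X ω : ℂ)) ∂P =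
      Complex.exp (-∫ q, stableExponent a (f q) ∂m) := by
  have h := hX.charFun_eq ha hM 1
  rw [charFun_apply_real, integral_map hX.measurable.aemeasurable
    (by fun_prop : Continuous _).aestronglyMeasurable] at h
  simpa [mul_comm] using h

end IsStableIntegral

theorem exists_isStableIntegral (ha : 0 < a) (hM : IsStableRandomMeasure P m a M) {f : S → ℝ}
    (hf : MemLp f (ENNReal.ofReal a) m) : ∃ Y, IsStableIntegral P m a M f Y := by
  obtain ⟨F, hF⟩ := exists_isSimpleApprox ha hf
  obtain ⟨Y, hY, hlim⟩ := exists_tendstoInMeasure_of_cauchy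
    (fun n => (measurable_simpleStableIntegral hM (hF.finMeasSupp n)).aestronglyMeasurable)
    (hF.tendstoInMeasure_sub ha hM hF)
  exact ⟨Y, .of_isSimpleApprox ha hM hY.measurable hF hlim⟩

namespace IsStableIntegral

theorem zero (ha : 0 < a) (hM : IsStableRandomMeasure P m a M) :
    IsStableIntegral P m a M 0 0 := by
  obtain ⟨Y, hY⟩ := exists_isStableIntegral ha hM MemLp.zero
  simpa using hY.smul_add_smul ha hM hY 0 0

theorem sum (ha : 0 < a) (hM : IsStableRandomMeasure P m a M) {ι : Type*} (T : Finset ι)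
    (z : ι → ℝ) {f : ι → S → ℝ} {X : ι → Ω → ℝ}
    (hX : ∀ t ∈ T, IsStableIntegral P m a M (f t) (X t)) :
    IsStableIntegral P m a M (∑ t ∈ T, z t • f t) (∑ t ∈ T, z t • X t) := by
  classical
  induction T using Finset.induction_on with
  | empty => simpa using zero ha hM
  | insert i T hi ih =>
    simpa only [Finset.sum_insert hi, one_smul] using
      (hX i (Finset.mem_insert_self _ _)).smul_add_smul ha hM
        (ih fun t ht => hX t (Finset.mem_insert_of_mem ht)) (z i) 1

end IsStableIntegral

theorem stableIntegralProcessWellDefined_of_memLp (ha : 0 < a)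
    (hM : IsStableRandomMeasure P m a M) {f : ℝ → S → ℝ}
    (hf : ∀ t, 0 ≤ t → MemLp (f t) (ENNReal.ofReal a) m) :
    StableIntegralProcessWellDefined P m a M f := by
  choose! X hX using fun t ht => exists_isStableIntegral ha hM (hf t ht)
  refine ⟨hf, X, hX, fun X' hX' t ht => (hX' t ht).ae_eq (hX t ht), fun T z hT => ?_⟩
  simpa using (IsStableIntegral.sum ha hM T z fun t ht => hX t (hT t ht)).integral_exp ha hM

end StableIntegral

section FourierPositive

variable {V : Type*} [NormedAddCommGroup V] [InnerProductSpace ℝ V]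

theorem norm_mul_cos_le (f : V → ℝ) (x y : V) : ‖f y * Real.cos (inner ℝ x y)‖ ≤ ‖f y‖ := by
  rw [norm_mul]
  exact mul_le_of_le_one_right (norm_nonneg _) (Real.abs_cos_le_one _)

variable [FiniteDimensional ℝ V] [MeasurableSpace V] [BorelSpace V]

theorem integrable_exp_neg_mul_sq_norm {δ : ℝ} (hδ : 0 < δ) :
    Integrable fun y : V => Real.exp (-δ * ‖y‖ ^ 2) := by
  have h := (GaussianFourier.integrable_cexp_neg_mul_sq_norm_add (V := V) (b := (δ : ℂ))
    (by simpa using hδ) 0 0).norm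
  refine h.congr (Eventually.of_forall fun y => ?_)
  simp only [zero_mul, add_zero, Complex.norm_exp]
  norm_cast

theorem integral_exp_neg_mul_sq_norm_mul_cos {δ : ℝ} (hδ : 0 < δ) (x : V) :
    ∫ y : V, Real.exp (-δ * ‖y‖ ^ 2) * Real.cos (inner ℝ x y) =
      (Real.pi / δ) ^ ((Module.finrank ℝ V : ℝ) / 2) * Real.exp (-(4 * δ)⁻¹ * ‖x‖ ^ 2) := by
  have hδ' : 0 < ((δ : ℂ)).re := by simpa using hδ
  have integrand_re (y : V) : RCLike.re (Complex.exp (-(δ : ℂ) * ‖y‖ ^ 2 +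
      Complex.I * ((inner ℝ x y : ℝ) : ℂ))) =
      Real.exp (-δ * ‖y‖ ^ 2) * Real.cos (inner ℝ x y) := by
    have hexp : Complex.exp (-(δ : ℂ) * ‖y‖ ^ 2) = ((Real.exp (-δ * ‖y‖ ^ 2) : ℝ) : ℂ) := by
      push_cast; rfl
    rw [Complex.exp_add, mul_comm Complex.I, hexp, RCLike.re_eq_complex_re,
      Complex.re_ofReal_mul, Complex.exp_ofReal_mul_I_re]
  have value_eq : ((Real.pi : ℂ) / δ) ^ ((Module.finrank ℝ V : ℂ) / 2) *
      Complex.exp (Complex.I ^ 2 * (‖x‖ : ℂ) ^ 2 / (4 * δ)) =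
      (((Real.pi / δ) ^ ((Module.finrank ℝ V : ℝ) / 2) *
        Real.exp (-(4 * δ)⁻¹ * ‖x‖ ^ 2) : ℝ) : ℂ) := by
    push_cast
    rw [Complex.ofReal_cpow (by positivity), Complex.I_sq]
    push_cast
    congr 2
    field_simp
  have h := integral_re (𝕜 := ℂ)
    (GaussianFourier.integrable_cexp_neg_mul_sq_norm_add hδ' Complex.I x)
  rw [GaussianFourier.integral_cexp_neg_mul_sq_norm_add hδ' Complex.I x, value_eq] at h
  simpa only [integrand_re, RCLike.re_eq_complex_re, Complex.ofReal_re] using h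

/-- The cosine transform `x ↦ ∫ f(y) cos⟨x, y⟩ dy`: the real part of the Fourier transform of `f`,
without normalization. -/
def cosTransform (f : V → ℝ) (x : V) : ℝ :=
  ∫ y, f y * Real.cos (inner ℝ x y)

theorem integrable_mul_cos {f : V → ℝ} (hf : Integrable f) (x : V) :
    Integrable fun y => f y * Real.cos (inner ℝ x y) :=
  hf.norm.mono' (hf.1.mul (by fun_prop)) (Eventually.of_forall (norm_mul_cos_le f x))

theorem abs_cosTransform_le {f : V → ℝ} (hf : Integrable f) (x : V) :
    |cosTransform f x| ≤ ∫ y, ‖f y‖ :=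
  norm_integral_le_of_norm_le hf.norm (Eventually.of_forall (norm_mul_cos_le f x))

theorem stronglyMeasurable_cosTransform {f : V → ℝ} (hf : Measurable f) :
    StronglyMeasurable (cosTransform f) := by
  have h : Measurable (Function.uncurry fun x y : V => f y * Real.cos (inner ℝ x y)) := by
    unfold Function.uncurry
    fun_prop
  exact h.stronglyMeasurable.integral_prod_right

theorem tendsto_cosTransform {f : V → ℝ} {F : ℕ → V → ℝ} {g : V → ℝ} (hF : ∀ n, Measurable (F n))
    (hg : Integrable g) (hFg : ∀ n y, |F n y| ≤ g y)
    (hlim : ∀ y, Tendsto (fun n => F n y) atTop (𝓝 (f y))) (x : V) :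
    Tendsto (fun n => cosTransform (F n) x) atTop (𝓝 (cosTransform f x)) :=
  tendsto_integral_of_dominated_convergence g
    (fun n => ((hF n).mul (by fun_prop)).aestronglyMeasurable) hg
    (fun n => Eventually.of_forall fun y => (norm_mul_cos_le _ _ _).trans (hFg n y))
    (Eventually.of_forall fun y => (hlim y).mul_const _)

theorem tendsto_mul_exp_neg_inv_mul (c s : ℝ) :
    Tendsto (fun n : ℕ => c * Real.exp (-((n : ℝ) + 1)⁻¹ * s)) atTop (𝓝 c) := by
  have h := (((tendsto_one_div_add_atTop_nhds_zero_nat (𝕜 := ℝ)).neg.mul_const s).rexp).const_mul c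
  simpa only [one_div, neg_zero, zero_mul, Real.exp_zero, mul_one] using h

/-- `φ` is bounded and all its Gaussian regularizations `φ(y) exp(-δ‖y‖²)`, `δ > 0`, have a
nonnegative cosine transform. For even continuous `φ` this is positive definiteness; the
regularization makes sense of the transform of a function which is not integrable. -/
structure IsFourierPositive (φ : V → ℝ) : Prop where
  measurable : Measurable φ
  bounded : ∃ C, ∀ y, |φ y| ≤ C
  nonneg : ∀ δ : ℝ, 0 < δ → ∀ x, 0 ≤ cosTransform (fun y => φ y * Real.exp (-δ * ‖y‖ ^ 2)) x

namespace IsFourierPositive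

variable {φ ψ : V → ℝ}

theorem integrable_mul_exp (hφ : IsFourierPositive φ) {δ : ℝ} (hδ : 0 < δ) :
    Integrable fun y => φ y * Real.exp (-δ * ‖y‖ ^ 2) :=
  have ⟨_, hC⟩ := hφ.bounded
  (integrable_exp_neg_mul_sq_norm hδ).bdd_mul hφ.measurable.aestronglyMeasurable
    (Eventually.of_forall hC)

protected theorem one : IsFourierPositive fun _ : V => 1 where
  measurable := measurable_const
  bounded := ⟨1, fun _ => by rw [abs_one]⟩
  nonneg δ hδ x := by
    simp only [cosTransform, one_mul]
    rw [integral_exp_neg_mul_sq_norm_mul_cos hδ]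
    positivity

protected theorem add (hφ : IsFourierPositive φ) (hψ : IsFourierPositive ψ) :
    IsFourierPositive fun y => φ y + ψ y where
  measurable := hφ.measurable.add hψ.measurable
  bounded := by
    obtain ⟨C, hC⟩ := hφ.bounded
    obtain ⟨D, hD⟩ := hψ.bounded
    exact ⟨C + D, fun y => (abs_add_le _ _).trans (add_le_add (hC y) (hD y))⟩
  nonneg δ hδ x := by
    simp only [cosTransform, add_mul]
    rw [integral_add (integrable_mul_cos (hφ.integrable_mul_exp hδ) x)
      (integrable_mul_cos (hψ.integrable_mul_exp hδ) x)]
    exact add_nonneg (hφ.nonneg δ hδ x) (hψ.nonneg δ hδ x)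

protected theorem const_mul (hφ : IsFourierPositive φ) {c : ℝ} (hc : 0 ≤ c) :
    IsFourierPositive fun y => c * φ y where
  measurable := hφ.measurable.const_mul c
  bounded := by
    obtain ⟨C, hC⟩ := hφ.bounded
    refine ⟨c * C, fun y => ?_⟩
    rw [abs_mul, abs_of_nonneg hc]
    exact mul_le_mul_of_nonneg_left (hC y) hc
  nonneg δ hδ x := by
    simp only [cosTransform, mul_assoc c]
    rw [integral_const_mul]
    exact mul_nonneg hc (hφ.nonneg δ hδ x)

theorem of_tendsto {Φ : ℕ → V → ℝ} {C : ℝ} (hΦ : ∀ n, IsFourierPositive (Φ n))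
    (hC : ∀ n y, |Φ n y| ≤ C) (hlim : ∀ y, Tendsto (fun n => Φ n y) atTop (𝓝 (φ y))) :
    IsFourierPositive φ where
  measurable := measurable_of_tendsto_metrizable (fun n => (hΦ n).measurable)
    (tendsto_pi_nhds.2 hlim)
  bounded := ⟨C, fun y => le_of_tendsto' (hlim y).abs fun n => hC n y⟩
  nonneg δ hδ x := by
    refine ge_of_tendsto' (tendsto_cosTransform
      (F := fun n y => Φ n y * Real.exp (-δ * ‖y‖ ^ 2))
      (fun n => (hΦ n).measurable.mul (by fun_prop))
      ((integrable_exp_neg_mul_sq_norm hδ).const_mul C) (fun n y => ?_)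
      (fun y => (hlim y).mul_const _) x) fun n => (hΦ n).nonneg δ hδ x
    rw [abs_mul, Real.abs_exp]
    exact mul_le_mul_of_nonneg_right (hC n y) (Real.exp_pos _).le

theorem integral_of_ae {ι : Type*} [MeasurableSpace ι] {ν : Measure ι} [SFinite ν]
    {k : ι → V → ℝ} {w : ι → ℝ} (hk : Measurable (Function.uncurry k)) (hw : Integrable w ν)
    (hkw : ∀ᵐ l ∂ν, ∀ y, |k l y| ≤ w l) (hpos : ∀ᵐ l ∂ν, IsFourierPositive (k l)) :
    IsFourierPositive fun y => ∫ l, k l y ∂ν where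
  measurable := hk.stronglyMeasurable.integral_prod_left.measurable
  bounded := ⟨∫ l, w l ∂ν, fun y =>
    norm_integral_le_of_norm_le (f := fun l => k l y) hw (hkw.mono fun _ h => h y)⟩
  nonneg δ hδ x := by
    let f : V → ι → ℝ := fun y l => k l y * Real.exp (-δ * ‖y‖ ^ 2) * Real.cos (inner ℝ x y)
    have hf : Integrable (Function.uncurry f) (volume.prod ν) := by
      refine ((integrable_exp_neg_mul_sq_norm hδ).mul_prod hw).mono'
        (Measurable.aestronglyMeasurable ?_) ?_
      · have := hk.comp (measurable_swap (α := V) (β := ι))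
        exact (this.mul (by fun_prop)).mul (by fun_prop)
      · filter_upwards [Measure.quasiMeasurePreserving_snd.ae hkw] with q hq
        refine (norm_mul_cos_le (fun y => k q.2 y * Real.exp (-δ * ‖y‖ ^ 2)) x q.1).trans ?_
        rw [norm_mul, Real.norm_eq_abs, Real.norm_of_nonneg (Real.exp_pos _).le, mul_comm]
        exact mul_le_mul_of_nonneg_left (hq q.1) (Real.exp_pos _).le
    have hswap : cosTransform (fun y => (∫ l, k l y ∂ν) * Real.exp (-δ * ‖y‖ ^ 2)) x =
        ∫ l, cosTransform (fun y => k l y * Real.exp (-δ * ‖y‖ ^ 2)) x ∂ν := by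
      simp only [cosTransform, ← integral_mul_const]
      exact integral_integral_swap hf
    rw [hswap]
    exact integral_nonneg_of_ae (hpos.mono fun l h => h.nonneg δ hδ x)

theorem mul_exp_neg (hφ : IsFourierPositive φ) {l : ℝ} (hl : 0 ≤ l) :
    IsFourierPositive fun y => φ y * Real.exp (-l * ‖y‖ ^ 2) where
  measurable := hφ.measurable.mul (by fun_prop)
  bounded := by
    obtain ⟨C, hC⟩ := hφ.bounded
    refine ⟨C, fun y => ?_⟩
    rw [abs_mul, Real.abs_exp]
    refine (mul_le_of_le_one_right (abs_nonneg _) (Real.exp_le_one_iff.2 ?_)).trans (hC y)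
    exact mul_nonpos_of_nonpos_of_nonneg (neg_nonpos.2 hl) (sq_nonneg _)
  nonneg δ hδ x := by
    have h (y : V) : φ y * Real.exp (-l * ‖y‖ ^ 2) * Real.exp (-δ * ‖y‖ ^ 2) =
        φ y * Real.exp (-(l + δ) * ‖y‖ ^ 2) := by
      rw [mul_assoc, ← Real.exp_add]
      ring_nf
    simp only [h]
    exact hφ.nonneg (l + δ) (by positivity) x

theorem mul_inv_add_sq_norm (hφ : IsFourierPositive φ) {u : ℝ} (hu : 0 < u) :
    IsFourierPositive fun y => φ y * (u + ‖y‖ ^ 2)⁻¹ := by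
  obtain ⟨C, hC⟩ := hφ.bounded
  have hinv (y : V) : φ y * (u + ‖y‖ ^ 2)⁻¹ =
      ∫ l in Set.Ioi 0, Real.exp (-u * l) * (φ y * Real.exp (-l * ‖y‖ ^ 2)) := by
    have hneg : -(u + ‖y‖ ^ 2) < 0 := neg_lt_zero.2 (by positivity)
    have h := integral_exp_mul_Ioi hneg 0
    rw [mul_zero, Real.exp_zero, neg_div_neg_eq, one_div] at h
    rw [← h, ← integral_const_mul]
    refine integral_congr_ae (Eventually.of_forall fun l => ?_)
    simp only
    rw [mul_left_comm, ← Real.exp_add]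
    ring_nf
  simp only [hinv]
  refine integral_of_ae (w := fun l => Real.exp (-u * l) * C) ?_
    ((integrableOn_exp_mul_Ioi (neg_lt_zero.2 hu) 0).mul_const C) ?_ ?_
  · have := hφ.measurable
    unfold Function.uncurry
    fun_prop
  · filter_upwards [ae_restrict_mem measurableSet_Ioi] with l hl y
    rw [abs_mul, Real.abs_exp, abs_mul, Real.abs_exp]
    have : Real.exp (-l * ‖y‖ ^ 2) ≤ 1 := Real.exp_le_one_iff.2
      (mul_nonpos_of_nonpos_of_nonneg (neg_nonpos.2 (Set.mem_Ioi.1 hl).le) (sq_nonneg _))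
    gcongr
    exact (mul_le_of_le_one_right (abs_nonneg _) this).trans (hC y)
  · filter_upwards [ae_restrict_mem measurableSet_Ioi] with l hl
    exact (hφ.mul_exp_neg (Set.mem_Ioi.1 hl).le).const_mul (Real.exp_pos _).le

/-- The exponential is the limit of `(1 + ψ / n) ^ n`, a polynomial in `ψ` with nonnegative
coefficients. -/
theorem exp_of_mul (hψ0 : ∀ y, 0 ≤ ψ y)
    (hψ : ∀ φ : V → ℝ, IsFourierPositive φ → IsFourierPositive fun y => φ y * ψ y) :
    IsFourierPositive fun y => Real.exp (ψ y) := by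
  have hpow (c : ℝ) (hc : 0 ≤ c) (n : ℕ) : IsFourierPositive fun y => (1 + c * ψ y) ^ n := by
    induction n with
    | zero => simpa only [pow_zero] using IsFourierPositive.one
    | succ n ih =>
      convert ih.add ((hψ _ ih).const_mul hc) using 2 with y
      ring
  obtain ⟨C, hC⟩ := (hψ _ IsFourierPositive.one).bounded
  refine of_tendsto (Φ := fun n y => (1 + (n : ℝ)⁻¹ * ψ y) ^ n) (C := Real.exp C)
    (fun n => hpow _ (by positivity) n) (fun n y => ?_) fun y => ?_
  · have h0 := hψ0 y
    have hψC : ψ y ≤ C := by simpa only [one_mul, abs_of_nonneg h0] using hC y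
    rw [abs_of_nonneg (by positivity)]
    calc (1 + (n : ℝ)⁻¹ * ψ y) ^ n ≤ Real.exp ((n : ℝ)⁻¹ * ψ y) ^ n := by
          gcongr
          rw [add_comm]
          exact Real.add_one_le_exp _
      _ = Real.exp ((n * (n : ℝ)⁻¹) * ψ y) := by rw [← Real.exp_nat_mul, mul_assoc]
      _ ≤ Real.exp (1 * ψ y) := by gcongr; exact mul_inv_le_one
      _ ≤ Real.exp C := by rw [one_mul]; exact Real.exp_le_exp.2 hψC
  · simpa only [div_eq_inv_mul] using Real.tendsto_one_add_div_pow_exp (ψ y)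

end IsFourierPositive

theorem integrableOn_rpow_sub_one {γ : ℝ} (hγ : 0 < γ) (R : ℝ) :
    IntegrableOn (fun u : ℝ => u ^ (γ - 1)) (Set.Ioc 0 R) :=
  (intervalIntegral.intervalIntegrable_rpow' (by linarith)).1

theorem rpow_mul_inv_add_le (γ : ℝ) {u s : ℝ} (hu : 0 < u) (hs : 0 ≤ s) :
    u ^ γ * (u + s)⁻¹ ≤ u ^ (γ - 1) := by
  rw [Real.rpow_sub_one hu.ne', div_eq_mul_inv]
  gcongr
  exact le_add_of_nonneg_right hs

namespace IsFourierPositive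
variable {φ : V → ℝ}

theorem mul_integral_rpow_mul_inv {γ : ℝ} (hγ : 0 < γ) (hφ : IsFourierPositive φ) (R : ℝ) :
    IsFourierPositive fun y => φ y * ∫ u in Set.Ioc 0 R, u ^ γ * (u + ‖y‖ ^ 2)⁻¹ := by
  obtain ⟨C, hC⟩ := hφ.bounded
  have hpos : ∀ᵐ u ∂volume.restrict (Set.Ioc 0 R), 0 < u :=
    (ae_restrict_mem measurableSet_Ioc).mono fun u hu => hu.1
  simp only [← integral_const_mul]
  refine integral_of_ae (w := fun u => C * u ^ (γ - 1)) ?_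
    ((integrableOn_rpow_sub_one hγ R).const_mul C) ?_ ?_
  · have := hφ.measurable
    unfold Function.uncurry
    fun_prop
  · filter_upwards [hpos] with u hu y
    rw [abs_mul, abs_of_nonneg (a := _ * _) (by positivity)]
    exact mul_le_mul (hC y) (rpow_mul_inv_add_le γ hu (sq_nonneg _)) (by positivity)
      ((abs_nonneg _).trans (hC y))
  · filter_upwards [hpos] with u hu
    convert (hφ.mul_inv_add_sq_norm hu).const_mul (c := u ^ γ) (by positivity) using 2
    ring

/-- The integrand of `Real.rpowIntegrand₀₁` is `u^(γ-1) - u^γ (u + ‖y‖²)⁻¹`, so the function is,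
up to the positive factor `exp(-c ∫_0^R u^(γ-1) du)`, the exponential of a mixture of resolvents. -/
theorem exp_neg_integral_rpowIntegrand {γ c : ℝ} (hγ : γ ∈ Set.Ioo 0 1) (hc : 0 ≤ c) (R : ℝ) :
    IsFourierPositive fun y : V =>
      Real.exp (-(c * ∫ u in Set.Ioc 0 R, Real.rpowIntegrand₀₁ γ u (‖y‖ ^ 2))) := by
  have hpos : ∀ᵐ u ∂volume.restrict (Set.Ioc 0 R), 0 < u :=
    (ae_restrict_mem measurableSet_Ioc).mono fun u hu => hu.1
  let ψ : V → ℝ := fun y => c * ∫ u in Set.Ioc 0 R, u ^ γ * (u + ‖y‖ ^ 2)⁻¹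
  have hψ0 (y : V) : 0 ≤ ψ y := mul_nonneg hc <|
    integral_nonneg_of_ae (hpos.mono fun u hu => by simp only [Pi.zero_apply]; positivity)
  have hψ (φ : V → ℝ) (hφ : IsFourierPositive φ) : IsFourierPositive fun y => φ y * ψ y := by
    simpa only [ψ, mul_left_comm] using (hφ.mul_integral_rpow_mul_inv hγ.1 R).const_mul hc
  convert (exp_of_mul hψ0 hψ).const_mul
    (Real.exp_pos (-(c * ∫ u in Set.Ioc 0 R, u ^ (γ - 1)))).le using 2 with y
  have hint := integrableOn_rpow_sub_one hγ.1 R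
  have hψint : IntegrableOn (fun u => u ^ γ * (u + ‖y‖ ^ 2)⁻¹) (Set.Ioc 0 R) := by
    refine hint.mono' (by fun_prop) (hpos.mono fun u hu => ?_)
    rw [Real.norm_of_nonneg (by positivity)]
    exact rpow_mul_inv_add_le γ hu (sq_nonneg _)
  rw [← Real.exp_add, neg_add_eq_sub, ← neg_sub, ← mul_sub, ← integral_sub hint hψint]
  congr 3
  refine integral_congr_ae (hpos.mono fun u hu => ?_)
  simp only [Real.rpowIntegrand₀₁_eq_sub hγ.2.ne hu]

theorem exp_neg_mul_sq_norm_rpow {γ t : ℝ} (hγ : γ ∈ Set.Ioo 0 1) (ht : 0 ≤ t) :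
    IsFourierPositive fun y : V => Real.exp (-(t * (‖y‖ ^ 2) ^ γ)) := by
  let c := t * (∫ u in Set.Ioi 0, Real.rpowIntegrand₀₁ γ u 1)⁻¹
  have hc : 0 ≤ c := mul_nonneg ht (inv_nonneg.2 (Real.integral_rpowIntegrand₀₁_one_pos hγ).le)
  have hlim (y : V) : Tendsto
      (fun n : ℕ => ∫ u in Set.Ioc 0 (n : ℝ), Real.rpowIntegrand₀₁ γ u (‖y‖ ^ 2)) atTop
      (𝓝 (∫ u in Set.Ioi 0, Real.rpowIntegrand₀₁ γ u (‖y‖ ^ 2))) := by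
    have h := intervalIntegral_tendsto_integral_Ioi 0
      (Real.integrableOn_rpowIntegrand₀₁_Ioi hγ (sq_nonneg ‖y‖)) tendsto_natCast_atTop_atTop
    exact h.congr fun n => intervalIntegral.integral_of_le n.cast_nonneg
  refine of_tendsto (C := 1) (fun n => exp_neg_integral_rpowIntegrand hγ hc n)
    (fun n y => ?_) fun y => ?_
  · rw [Real.abs_exp, Real.exp_le_one_iff, neg_nonpos]
    exact mul_nonneg hc (setIntegral_nonneg measurableSet_Ioc fun u hu =>
      Real.rpowIntegrand₀₁_nonneg hγ.1 hu.1.le (sq_nonneg _))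
  · rw [Real.rpow_eq_const_mul_integral hγ (sq_nonneg _), ← mul_assoc]
    exact ((hlim y).const_mul c).neg.rexp

theorem cosTransform_nonneg {φ : V → ℝ} (hφ : IsFourierPositive φ) (hint : Integrable φ) (x : V) :
    0 ≤ cosTransform φ x := by
  refine ge_of_tendsto' (tendsto_cosTransform
    (F := fun n y => φ y * Real.exp (-((n : ℝ) + 1)⁻¹ * ‖y‖ ^ 2))
    (fun n => hφ.measurable.mul (by fun_prop)) hint.norm (fun n y => ?_)
    (fun y => tendsto_mul_exp_neg_inv_mul _ _) x) fun n => hφ.nonneg _ (by positivity) x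
  rw [abs_mul, Real.abs_exp, Real.norm_eq_abs]
  refine mul_le_of_le_one_right (abs_nonneg _) (Real.exp_le_one_iff.2 ?_)
  exact mul_nonpos_of_nonpos_of_nonneg (neg_nonpos.2 (by positivity)) (sq_nonneg _)

end IsFourierPositive

theorem isFourierPositive_exp_neg_mul_norm_rpow {α t : ℝ} (hα : 0 < α) (hα2 : α ≤ 2)
    (ht : 0 ≤ t) : IsFourierPositive fun y : V => Real.exp (-(t * ‖y‖ ^ α)) := by
  rcases hα2.eq_or_lt with rfl | hα2
  · simpa only [one_mul, neg_mul, Real.rpow_two] using IsFourierPositive.one.mul_exp_neg ht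
  · have hsq (y : V) : (‖y‖ ^ 2) ^ (α / 2) = ‖y‖ ^ α := by
      rw [← Real.rpow_two, ← Real.rpow_mul (norm_nonneg y), mul_div_cancel₀ _ two_ne_zero]
    simpa only [hsq] using IsFourierPositive.exp_neg_mul_sq_norm_rpow (V := V) (γ := α / 2)
      ⟨by linarith, by linarith⟩ ht

theorem integral_cosTransform_mul_exp {f : V → ℝ} (hf : Integrable f) {δ : ℝ} (hδ : 0 < δ) :
    ∫ x, cosTransform f x * Real.exp (-δ * ‖x‖ ^ 2) =
      ∫ y, f y * ((Real.pi / δ) ^ ((Module.finrank ℝ V : ℝ) / 2) *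
        Real.exp (-(4 * δ)⁻¹ * ‖y‖ ^ 2)) := by
  let F : V → V → ℝ := fun x y => f y * (Real.exp (-δ * ‖x‖ ^ 2) * Real.cos (inner ℝ y x))
  have hF : Integrable (Function.uncurry F) (volume.prod volume) := by
    have hprod := (integrable_exp_neg_mul_sq_norm (V := V) hδ).mul_prod hf
    refine hprod.norm.mono' ?_ (Eventually.of_forall fun q => ?_)
    · exact hf.1.comp_snd.mul (Continuous.aestronglyMeasurable (by fun_prop))
    · simp only [Function.uncurry, F]
      rw [norm_mul (f q.2), norm_mul _ (f q.2), mul_comm]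
      exact mul_le_mul_of_nonneg_right
        (norm_mul_cos_le (fun x => Real.exp (-δ * ‖x‖ ^ 2)) q.2 q.1) (norm_nonneg _)
  have hleft (x : V) : cosTransform f x * Real.exp (-δ * ‖x‖ ^ 2) = ∫ y, F x y := by
    rw [cosTransform, ← integral_mul_const]
    refine integral_congr_ae (Eventually.of_forall fun y => ?_)
    simp only [F, real_inner_comm]
    ring
  simp only [hleft]
  rw [integral_integral_swap hF]
  simp only [F, integral_const_mul, integral_exp_neg_mul_sq_norm_mul_cos hδ]

theorem integral_cosTransform_mul_exp_le {f : V → ℝ} (hf : Integrable f) {C : ℝ}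
    (hC : ∀ y, |f y| ≤ C) {δ : ℝ} (hδ : 0 < δ) :
    ∫ x, cosTransform f x * Real.exp (-δ * ‖x‖ ^ 2) ≤ (2 * Real.pi) ^ Module.finrank ℝ V * C := by
  have hδ4 : 0 < (4 * δ)⁻¹ := by positivity
  set d : ℝ := (Module.finrank ℝ V : ℝ) / 2
  have hgauss : Integrable fun y : V =>
      C * ((Real.pi / δ) ^ d * Real.exp (-(4 * δ)⁻¹ * ‖y‖ ^ 2)) :=
    ((integrable_exp_neg_mul_sq_norm hδ4).const_mul _).const_mul C
  have hconst : (Real.pi / δ) ^ d * (Real.pi / (4 * δ)⁻¹) ^ d =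
      (2 * Real.pi) ^ Module.finrank ℝ V := by
    rw [← Real.mul_rpow (by positivity) (by positivity)]
    have h : Real.pi / δ * (Real.pi / (4 * δ)⁻¹) = (2 * Real.pi) ^ (2 : ℝ) := by
      rw [Real.rpow_two]; field_simp; ring
    rw [h, ← Real.rpow_mul (by positivity), mul_div_cancel₀ _ two_ne_zero, Real.rpow_natCast]
  rw [integral_cosTransform_mul_exp hf hδ]
  calc _ ≤ ∫ y : V, C * ((Real.pi / δ) ^ d * Real.exp (-(4 * δ)⁻¹ * ‖y‖ ^ 2)) := by
        refine (Real.le_norm_self _).trans (norm_integral_le_of_norm_le hgauss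
          (Eventually.of_forall fun y => ?_))
        rw [norm_mul, Real.norm_of_nonneg (r := _ * _) (by positivity)]
        exact mul_le_mul_of_nonneg_right (hC y) (by positivity)
    _ = (2 * Real.pi) ^ Module.finrank ℝ V * C := by
        rw [integral_const_mul, integral_const_mul,
          GaussianFourier.integral_rexp_neg_mul_sq_norm hδ4, hconst, mul_comm]

/-- This stands in for Fourier inversion at the origin: the Gaussian regularizations have mass at
most `(2π)^d C`, and Fatou's lemma removes the regularization. -/
theorem lintegral_cosTransform_le {f : V → ℝ} (hf : Integrable f) (hfm : Measurable f) {C : ℝ}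
    (hC : ∀ y, |f y| ≤ C) (hpos : ∀ x, 0 ≤ cosTransform f x) :
    ∫⁻ x, ENNReal.ofReal (cosTransform f x) ≤
      ENNReal.ofReal ((2 * Real.pi) ^ Module.finrank ℝ V * C) := by
  have hm := (stronglyMeasurable_cosTransform hfm).measurable
  let F : ℕ → V → ENNReal := fun n x =>
    ENNReal.ofReal (cosTransform f x * Real.exp (-((n : ℝ) + 1)⁻¹ * ‖x‖ ^ 2))
  have hlim (x : V) : Tendsto (fun n => F n x) atTop (𝓝 (ENNReal.ofReal (cosTransform f x))) :=
    ENNReal.tendsto_ofReal (tendsto_mul_exp_neg_inv_mul _ _)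
  have hF (n : ℕ) : ∫⁻ x, F n x ≤ ENNReal.ofReal ((2 * Real.pi) ^ Module.finrank ℝ V * C) := by
    have hδ : 0 < ((n : ℝ) + 1)⁻¹ := by positivity
    have hint : Integrable fun x => cosTransform f x * Real.exp (-((n : ℝ) + 1)⁻¹ * ‖x‖ ^ 2) :=
      (integrable_exp_neg_mul_sq_norm hδ).bdd_mul hm.aestronglyMeasurable
        (Eventually.of_forall (abs_cosTransform_le hf))
    rw [← ofReal_integral_eq_lintegral_ofReal hint (Eventually.of_forall fun x =>
      mul_nonneg (hpos x) (Real.exp_pos _).le)]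
    exact ENNReal.ofReal_le_ofReal (integral_cosTransform_mul_exp_le hf hC hδ)
  calc ∫⁻ x, ENNReal.ofReal (cosTransform f x) = ∫⁻ x, liminf (fun n => F n x) atTop :=
        lintegral_congr fun x => (hlim x).liminf_eq.symm
    _ ≤ liminf (fun n => ∫⁻ x, F n x) atTop := lintegral_liminf_le fun n => by fun_prop
    _ ≤ _ := liminf_le_of_le (by isBoundedDefault) fun b hb =>
        have ⟨n, hn⟩ := hb.exists
        hn.trans (hF n)

end FourierPositive

section StableDensity

theorem integrable_exp_neg_mul_norm_rpow {V : Type*} [NormedAddCommGroup V] [NormedSpace ℝ V]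
    [FiniteDimensional ℝ V] [MeasurableSpace V] [BorelSpace V] (μ : Measure V)
    [μ.IsAddHaarMeasure] {α t : ℝ} (hα : 0 < α) (ht : 0 < t) :
    Integrable (fun y : V => Real.exp (-(t * ‖y‖ ^ α))) μ := by
  rcases subsingleton_or_nontrivial V with _ | _
  · exact Integrable.of_finite
  rw [integrable_fun_norm_addHaar μ (f := fun r => Real.exp (-(t * r ^ α)))]
  have hdim : -1 < ((Module.finrank ℝ V - 1 : ℕ) : ℝ) :=
    neg_one_lt_zero.trans_le (Nat.cast_nonneg _)
  simpa only [smul_eq_mul, Real.rpow_natCast, neg_mul] using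
    integrableOn_rpow_mul_exp_neg_mul_rpow hdim hα ht

theorem integral_exp_neg_mul_norm_rpow {V : Type*} [NormedAddCommGroup V] [NormedSpace ℝ V]
    [FiniteDimensional ℝ V] [MeasurableSpace V] [BorelSpace V] (μ : Measure V)
    [μ.IsAddHaarMeasure] {α t : ℝ} (hα : α ≠ 0) (ht : 0 < t) :
    ∫ y : V, Real.exp (-(t * ‖y‖ ^ α)) ∂μ =
      t ^ (-((Module.finrank ℝ V : ℝ) / α)) * ∫ y : V, Real.exp (-‖y‖ ^ α) ∂μ := by
  have h := Measure.integral_comp_smul μ (fun y : V => Real.exp (-‖y‖ ^ α)) (t ^ (1 / α))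
  have hscale (y : V) : ‖t ^ (1 / α) • y‖ ^ α = t * ‖y‖ ^ α := by
    rw [norm_smul, Real.norm_of_nonneg (by positivity), Real.mul_rpow (by positivity)
      (norm_nonneg _), ← Real.rpow_mul ht.le, one_div_mul_cancel hα, Real.rpow_one]
  simp only [hscale, smul_eq_mul] at h
  rw [h, abs_of_nonneg (by positivity), ← Real.rpow_natCast, ← Real.rpow_mul ht.le,
    ← Real.rpow_neg ht.le]
  congr 2
  ring

variable {d : ℕ} {α t : ℝ}

theorem measurable_stableDensity (d : ℕ) (α : ℝ) :
    Measurable (Function.uncurry (stableDensity d α)) := by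
  have h : Measurable (Function.uncurry
      fun (q : ℝ × EuclideanSpace ℝ (Fin d)) (y : EuclideanSpace ℝ (Fin d)) =>
        Complex.exp (-(Complex.I * ((inner ℝ q.2 y : ℝ) : ℂ))) *
        ((Real.exp (-(q.1 * ‖y‖ ^ α)) : ℝ) : ℂ)) := by
    unfold Function.uncurry
    fun_prop
  exact (Complex.measurable_re.comp
    h.stronglyMeasurable.integral_prod_right.measurable).const_mul _

theorem stableDensity_eq_cosTransform (hα : 0 < α) (ht : 0 < t) (x : EuclideanSpace ℝ (Fin d)) :
    stableDensity d α t x =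
      ((2 * Real.pi) ^ d)⁻¹ * cosTransform (fun y => Real.exp (-(t * ‖y‖ ^ α))) x := by
  have hnorm (y : EuclideanSpace ℝ (Fin d)) :
      ‖Complex.exp (-(Complex.I * ((inner ℝ x y : ℝ) : ℂ)))‖ = 1 := by
    rw [mul_comm, ← neg_mul, ← Complex.ofReal_neg, Complex.norm_exp_ofReal_mul_I]
  have hint : Integrable fun y : EuclideanSpace ℝ (Fin d) =>
      Complex.exp (-(Complex.I * ((inner ℝ x y : ℝ) : ℂ))) *
        ((Real.exp (-(t * ‖y‖ ^ α)) : ℝ) : ℂ) :=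
    (integrable_exp_neg_mul_norm_rpow volume hα ht).ofReal.bdd_mul (c := 1) (by fun_prop)
      (Eventually.of_forall fun y => (hnorm y).le)
  have hre := integral_re (𝕜 := ℂ) hint
  simp only [RCLike.re_eq_complex_re] at hre
  rw [stableDensity, ← hre]
  congr 1
  refine integral_congr_ae (Eventually.of_forall fun y => ?_)
  simp only
  rw [Complex.re_mul_ofReal, mul_comm, mul_comm Complex.I, ← neg_mul _ Complex.I,
    ← Complex.ofReal_neg, Complex.exp_ofReal_mul_I_re, Real.cos_neg]

theorem cosTransform_exp_neg_mul_norm_rpow_nonneg (hα : 0 < α) (hα2 : α ≤ 2) (ht : 0 < t)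
    (x : EuclideanSpace ℝ (Fin d)) : 0 ≤ cosTransform (fun y => Real.exp (-(t * ‖y‖ ^ α))) x :=
  (isFourierPositive_exp_neg_mul_norm_rpow hα hα2 ht.le).cosTransform_nonneg
    (integrable_exp_neg_mul_norm_rpow volume hα ht) x

theorem stableDensity_nonneg (hα : 0 < α) (hα2 : α ≤ 2) (ht : 0 < t)
    (x : EuclideanSpace ℝ (Fin d)) : 0 ≤ stableDensity d α t x := by
  rw [stableDensity_eq_cosTransform hα ht]
  exact mul_nonneg (by positivity) (cosTransform_exp_neg_mul_norm_rpow_nonneg hα hα2 ht x)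

theorem abs_stableDensity_le (hα : 0 < α) (ht : 0 < t) (x : EuclideanSpace ℝ (Fin d)) :
    |stableDensity d α t x| ≤ ((2 * Real.pi) ^ d)⁻¹ *
      (∫ y : EuclideanSpace ℝ (Fin d), Real.exp (-‖y‖ ^ α)) * t ^ (-((d : ℝ) / α)) := by
  have hint := integrable_exp_neg_mul_norm_rpow
    (volume : Measure (EuclideanSpace ℝ (Fin d))) hα ht
  have hscale := integral_exp_neg_mul_norm_rpow
    (volume : Measure (EuclideanSpace ℝ (Fin d))) hα.ne' ht
  have habs := abs_cosTransform_le hint x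
  simp only [Real.norm_of_nonneg (Real.exp_pos _).le] at habs
  rw [finrank_euclideanSpace_fin, mul_comm] at hscale
  rw [stableDensity_eq_cosTransform hα ht, mul_assoc, ← hscale, abs_mul,
    abs_of_nonneg (by positivity)]
  exact mul_le_mul_of_nonneg_left habs (by positivity)

theorem lintegral_enorm_stableDensity_le_one (hα : 0 < α) (hα2 : α ≤ 2) (ht : 0 < t) :
    ∫⁻ x, ‖stableDensity d α t x‖ₑ ≤ 1 := by
  have hbound (y : EuclideanSpace ℝ (Fin d)) : |Real.exp (-(t * ‖y‖ ^ α))| ≤ 1 := by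
    rw [Real.abs_exp, Real.exp_le_one_iff, neg_nonpos]
    positivity
  have h := lintegral_cosTransform_le (integrable_exp_neg_mul_norm_rpow volume hα ht)
    (by fun_prop) hbound (cosTransform_exp_neg_mul_norm_rpow_nonneg hα hα2 ht)
  rw [finrank_euclideanSpace_fin, mul_one] at h
  simp only [Real.enorm_eq_ofReal (stableDensity_nonneg hα hα2 ht _)]
  simp only [stableDensity_eq_cosTransform hα ht,
    ENNReal.ofReal_mul (inv_nonneg.2 (pow_nonneg Real.two_pi_pos.le d))]
  rw [lintegral_const_mul' _ _ ENNReal.ofReal_ne_top]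
  calc _ ≤ ENNReal.ofReal ((2 * Real.pi) ^ d)⁻¹ * ENNReal.ofReal ((2 * Real.pi) ^ d) := by gcongr
    _ = 1 := by
      rw [← ENNReal.ofReal_mul (by positivity), inv_mul_cancel₀ (by positivity),
        ENNReal.ofReal_one]

end StableDensity

section OccupationDensity

theorem lintegral_ofReal_rpow_Ioc_lt_top {s : ℝ} (hs : -1 < s) (T : ℝ) :
    ∫⁻ u in Set.Ioc 0 T, ENNReal.ofReal (u ^ s) < ⊤ :=
  (intervalIntegral.intervalIntegrable_rpow' hs).1.lintegral_lt_top

/-- Hölder's inequality for `g = u^(-σ/b) · u^(σ/b) g`. -/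
theorem rpow_lintegral_Ioc_le {b : ℝ} (hb : 1 < b) (σ T : ℝ) {g : ℝ → ENNReal}
    (hg : Measurable g) :
    (∫⁻ u in Set.Ioc 0 T, g u) ^ b ≤
      (∫⁻ u in Set.Ioc 0 T, ENNReal.ofReal (u ^ (-(σ / (b - 1))))) ^ (b - 1) *
        ∫⁻ u in Set.Ioc 0 T, ENNReal.ofReal (u ^ σ) * g u ^ b := by
  have hb0 : 0 < b := one_pos.trans hb
  have hb1 : 0 < b - 1 := sub_pos.2 hb
  have hconj : (b / (b - 1)).HolderConjugate b := (Real.HolderConjugate.conjExponent hb).symm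
  let f : ℝ → ENNReal := fun u => ENNReal.ofReal (u ^ (-(σ / b)))
  let h : ℝ → ENNReal := fun u => ENNReal.ofReal (u ^ (σ / b)) * g u
  have hfh : ∫⁻ u in Set.Ioc 0 T, g u = ∫⁻ u in Set.Ioc 0 T, (f * h) u := by
    refine setLIntegral_congr_fun measurableSet_Ioc fun u hu => ?_
    simp only [Pi.mul_apply, f, h]
    rw [← mul_assoc, ← ENNReal.ofReal_mul (Real.rpow_nonneg hu.1.le _), ← Real.rpow_add hu.1,
      neg_add_cancel, Real.rpow_zero, ENNReal.ofReal_one, one_mul]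
  have hf : ∫⁻ u in Set.Ioc 0 T, f u ^ (b / (b - 1)) =
      ∫⁻ u in Set.Ioc 0 T, ENNReal.ofReal (u ^ (-(σ / (b - 1)))) := by
    refine setLIntegral_congr_fun measurableSet_Ioc fun u hu => ?_
    simp only [f]
    rw [ENNReal.ofReal_rpow_of_nonneg (Real.rpow_nonneg hu.1.le _) (div_pos hb0 hb1).le,
      ← Real.rpow_mul hu.1.le, neg_mul, div_mul_div_cancel₀ hb0.ne']
  have hh : ∫⁻ u in Set.Ioc 0 T, h u ^ b =
      ∫⁻ u in Set.Ioc 0 T, ENNReal.ofReal (u ^ σ) * g u ^ b := by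
    refine setLIntegral_congr_fun measurableSet_Ioc fun u hu => ?_
    simp only [h]
    rw [ENNReal.mul_rpow_of_nonneg _ _ hb0.le,
      ENNReal.ofReal_rpow_of_nonneg (Real.rpow_nonneg hu.1.le _) hb0.le, ← Real.rpow_mul hu.1.le,
      div_mul_cancel₀ _ hb0.ne']
  have hHolder := ENNReal.rpow_le_rpow (ENNReal.lintegral_mul_le_Lp_mul_Lq
    (volume.restrict (Set.Ioc 0 T)) hconj (f := f) (g := h) (by fun_prop) (by fun_prop)) hb0.le
  rwa [← hfh, hf, hh, ENNReal.mul_rpow_of_nonneg _ _ hb0.le, ← ENNReal.rpow_mul,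
    ← ENNReal.rpow_mul, one_div_mul_cancel hb0.ne', ENNReal.rpow_one, one_div_div,
    div_mul_cancel₀ _ hb0.ne'] at hHolder

variable {X : Type*} [MeasurableSpace X] {μ : Measure X}

theorem lintegral_rpow_le_of_le {f : X → ENNReal} (hf : Measurable f) {D : ENNReal}
    (hfD : ∀ x, f x ≤ D) {b : ℝ} (hb : 1 ≤ b) :
    ∫⁻ x, f x ^ b ∂μ ≤ D ^ (b - 1) * ∫⁻ x, f x ∂μ := by
  have hb1 : 0 ≤ b - 1 := sub_nonneg.2 hb
  rw [← lintegral_const_mul _ hf]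
  refine lintegral_mono fun x => ?_
  calc f x ^ b = f x ^ (b - 1) * f x := by
        rw [← sub_add_cancel b 1, ENNReal.rpow_add_of_nonneg _ _ hb1 zero_le_one,
          ENNReal.rpow_one, add_sub_cancel_right]
    _ ≤ D ^ (b - 1) * f x := by gcongr; exact hfD x

theorem lintegral_enorm_rpow_le {f : X → ℝ} (hf : Measurable f) {u C κ b : ℝ} (hu : 0 < u)
    (hfC : ∀ x, |f x| ≤ C * u ^ (-κ)) (hf1 : ∫⁻ x, ‖f x‖ₑ ∂μ ≤ 1) (hb : 1 ≤ b) :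
    ∫⁻ x, ‖f x‖ₑ ^ b ∂μ ≤ ENNReal.ofReal C ^ (b - 1) * ENNReal.ofReal (u ^ (-(κ * (b - 1)))) := by
  have hb1 : 0 ≤ b - 1 := sub_nonneg.2 hb
  have hsup (x : X) : ‖f x‖ₑ ≤ ENNReal.ofReal C * ENNReal.ofReal (u ^ (-κ)) := by
    rw [← ENNReal.ofReal_mul' (Real.rpow_nonneg hu.le _), Real.enorm_eq_ofReal_abs]
    exact ENNReal.ofReal_le_ofReal (hfC x)
  calc ∫⁻ x, ‖f x‖ₑ ^ b ∂μ
      ≤ (ENNReal.ofReal C * ENNReal.ofReal (u ^ (-κ))) ^ (b - 1) * ∫⁻ x, ‖f x‖ₑ ∂μ :=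
        lintegral_rpow_le_of_le hf.enorm hsup hb
    _ ≤ (ENNReal.ofReal C * ENNReal.ofReal (u ^ (-κ))) ^ (b - 1) := mul_le_of_le_one_right' hf1
    _ = _ := by
        rw [ENNReal.mul_rpow_of_nonneg _ _ hb1,
          ENNReal.ofReal_rpow_of_nonneg (Real.rpow_nonneg hu.le _) hb1, ← Real.rpow_mul hu.le,
          neg_mul]

/-- The occupation density `∫_0^T |p_u(x)| du` at `x` up to time `T` of a process with transition
density `p`. -/
def occupationDensity (p : ℝ → X → ℝ) (T : ℝ) (x : X) : ENNReal :=
  ∫⁻ u in Set.Ioc 0 T, ‖p u x‖ₑ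

variable {p : ℝ → X → ℝ}

theorem measurable_occupationDensity (hp : Measurable (Function.uncurry p)) (T : ℝ) :
    Measurable (occupationDensity p T) :=
  Measurable.lintegral_prod_right (f := fun x u => ‖p u x‖ₑ) (hp.comp measurable_swap).enorm

theorem lintegral_occupationDensity_le [SFinite μ] (hp : Measurable (Function.uncurry p))
    (hp1 : ∀ u, 0 < u → ∫⁻ x, ‖p u x‖ₑ ∂μ ≤ 1) (T : ℝ) :
    ∫⁻ x, occupationDensity p T x ∂μ ≤ ENNReal.ofReal T := by
  unfold occupationDensity
  rw [lintegral_lintegral_swap (f := fun x u => ‖p u x‖ₑ)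
    (hp.comp measurable_swap).enorm.aemeasurable]
  refine (setLIntegral_mono' measurableSet_Ioc fun u hu => hp1 u hu.1).trans_eq ?_
  rw [setLIntegral_one, Real.volume_Ioc, sub_zero]

/-- The weight `u^σ` of Hölder's inequality must satisfy `σ < b - 1`, so that `u^(-σ/(b-1))` is
integrable at `0`, and `σ > κ(b - 1) - 1`, so that `u^σ ∫ p_u^b ≲ u^(σ - κ(b-1))` is. -/
theorem lintegral_occupationDensity_rpow_lt_top [SFinite μ] (hp : Measurable (Function.uncurry p))
    {C κ b : ℝ} (hpC : ∀ u, 0 < u → ∀ x, |p u x| ≤ C * u ^ (-κ))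
    (hp1 : ∀ u, 0 < u → ∫⁻ x, ‖p u x‖ₑ ∂μ ≤ 1) (hb : 1 < b) (hκ : κ * (b - 1) < b) (T : ℝ) :
    ∫⁻ x, occupationDensity p T x ^ b ∂μ < ⊤ := by
  have hb1 : 0 < b - 1 := sub_pos.2 hb
  obtain ⟨σ, hσκ, hσb⟩ : ∃ σ, κ * (b - 1) - 1 < σ ∧ σ < b - 1 := exists_between (by linarith)
  have hweight : (∫⁻ u in Set.Ioc 0 T, ENNReal.ofReal (u ^ (-(σ / (b - 1))))) ^ (b - 1) < ⊤ :=
    ENNReal.rpow_lt_top_of_nonneg hb1.le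
      (lintegral_ofReal_rpow_Ioc_lt_top (neg_lt_neg ((div_lt_one hb1).2 hσb)) T).ne
  have hpow (u : ℝ) (hu : u ∈ Set.Ioc 0 T) :
      ∫⁻ x, ENNReal.ofReal (u ^ σ) * ‖p u x‖ₑ ^ b ∂μ ≤
        ENNReal.ofReal C ^ (b - 1) * ENNReal.ofReal (u ^ (σ - κ * (b - 1))) := by
    rw [lintegral_const_mul' _ _ ENNReal.ofReal_ne_top, sub_eq_add_neg σ, Real.rpow_add hu.1,
      ENNReal.ofReal_mul (Real.rpow_nonneg hu.1.le _), mul_left_comm]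
    gcongr
    exact lintegral_enorm_rpow_le hp.of_uncurry_left hu.1 (hpC u hu.1) (hp1 u hu.1) hb.le
  have hswap : ∫⁻ x, (∫⁻ u in Set.Ioc 0 T, ENNReal.ofReal (u ^ σ) * ‖p u x‖ₑ ^ b) ∂μ < ⊤ := by
    rw [lintegral_lintegral_swap (by
      have := (hp.comp (measurable_swap (α := X) (β := ℝ))).enorm.pow_const b
      exact (Measurable.mul (by fun_prop) this).aemeasurable)]
    refine (setLIntegral_mono' measurableSet_Ioc hpow).trans_lt ?_
    rw [lintegral_const_mul _ (by fun_prop)]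
    exact ENNReal.mul_lt_top (ENNReal.rpow_lt_top_of_nonneg hb1.le ENNReal.ofReal_ne_top)
      (lintegral_ofReal_rpow_Ioc_lt_top (by linarith) T)
  refine (lintegral_mono fun x => rpow_lintegral_Ioc_le hb σ T
    (g := fun u => ‖p u x‖ₑ) hp.of_uncurry_right.enorm).trans_lt ?_
  rw [lintegral_const_mul' _ _ hweight.ne]
  exact ENNReal.mul_lt_top hweight hswap

end OccupationDensity

section TimeShiftedKernel

theorem enorm_integral_shift_le {X : Type*} (p : ℝ → X → ℝ) {r t : ℝ} (hr : r ∈ Set.Icc 0 t)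
    (x : X) : ‖∫ u in r..t, p (u - r) x‖ₑ ≤ occupationDensity p t x := by
  rw [intervalIntegral.integral_comp_sub_right (fun u => p u x) r, sub_self,
    intervalIntegral.integral_of_le (sub_nonneg.2 hr.2)]
  exact (enorm_integral_le_lintegral_enorm _).trans
    (lintegral_mono_set (Set.Ioc_subset_Ioc_right (sub_le_self t hr.1)))

variable {X : Type*} [MeasurableSpace X] {p : ℝ → X → ℝ}

theorem measurable_indicator_integral_shift (hp : Measurable (Function.uncurry p)) (t : ℝ) :
    Measurable fun q : ℝ × X =>
      (Set.Icc 0 t).indicator (fun r => ∫ u in r..t, p (u - r) q.2) q.1 := by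
  have hintegrand : StronglyMeasurable (Function.uncurry fun (q : ℝ × X) (u : ℝ) =>
      {z : (ℝ × X) × ℝ | z.1.1 < z.2 ∧ z.2 ≤ t}.indicator
        (fun z => p (z.2 - z.1.1) z.1.2) (q, u)) := by
    refine (Measurable.indicator ?_ ?_).stronglyMeasurable
    · exact hp.comp ((measurable_snd.sub measurable_fst.fst).prodMk measurable_fst.snd)
    · exact (measurableSet_lt measurable_fst.fst measurable_snd).inter
        (measurableSet_le measurable_snd measurable_const)
  have hstrip : MeasurableSet {q : ℝ × X | q.1 ∈ Set.Icc 0 t} := measurable_fst measurableSet_Icc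
  convert (hintegrand.integral_prod_right (ν := volume)).measurable.indicator hstrip using 2 with q
  by_cases hq : q.1 ∈ Set.Icc 0 t
  · rw [Set.indicator_of_mem hq, Set.indicator_of_mem (s := {q : ℝ × X | q.1 ∈ Set.Icc 0 t}) hq,
      intervalIntegral.integral_of_le hq.2, ← integral_indicator measurableSet_Ioc]
    rfl
  · rw [Set.indicator_of_notMem hq,
      Set.indicator_of_notMem (s := {q : ℝ × X | q.1 ∈ Set.Icc 0 t}) hq]

theorem ae_fst_ne_zero {μ : Measure X} : ∀ᵐ q ∂((volume : Measure ℝ).prod μ), q.1 ≠ 0 :=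
  Measure.quasiMeasurePreserving_fst.ae (Measure.ae_ne volume 0)

variable {μ : Measure X} [SFinite μ]

theorem memLp_indicator_mul_integral_shift (hp : Measurable (Function.uncurry p))
    {w : ℝ → X → ℝ} (hw : Measurable (Function.uncurry w)) {a : ℝ} (ha : 0 < a) {t : ℝ}
    (hfin : ∫⁻ x, (∫⁻ r in Set.Icc 0 t, ‖w r x‖ₑ ^ a) * occupationDensity p t x ^ a ∂μ < ⊤) :
    MemLp (fun q : ℝ × X =>
      (Set.Icc 0 t).indicator (fun r => w r q.2 * ∫ u in r..t, p (u - r) q.2) q.1)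
      (ENNReal.ofReal a) (volume.prod μ) := by
  have hmeas : Measurable fun q : ℝ × X =>
      (Set.Icc 0 t).indicator (fun r => w r q.2 * ∫ u in r..t, p (u - r) q.2) q.1 := by
    convert hw.mul (measurable_indicator_integral_shift hp t) using 2 with q
    exact Set.indicator_mul_right _ _ _
  have hle (x : X) (r : ℝ) :
      ‖(Set.Icc 0 t).indicator (fun r => w r x * ∫ u in r..t, p (u - r) x) r‖ₑ ^ a ≤
        (Set.Icc 0 t).indicator (fun r => ‖w r x‖ₑ ^ a * occupationDensity p t x ^ a) r := by
    by_cases hr : r ∈ Set.Icc 0 t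
    · rw [Set.indicator_of_mem hr, Set.indicator_of_mem hr, enorm_mul,
        ENNReal.mul_rpow_of_nonneg _ _ ha.le]
      gcongr
      exact enorm_integral_shift_le p hr x
    · rw [Set.indicator_of_notMem hr, Set.indicator_of_notMem hr, enorm_zero,
        ENNReal.zero_rpow_of_pos ha]
  refine ⟨hmeas.aestronglyMeasurable, ?_⟩
  rw [eLpNorm_lt_top_iff_lintegral_rpow_enorm_lt_top (ENNReal.ofReal_pos.2 ha).ne'
    ENNReal.ofReal_ne_top, ENNReal.toReal_ofReal ha.le,
    lintegral_prod_symm _ (hmeas.enorm.pow_const a).aemeasurable]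
  refine (lintegral_mono fun x => ?_).trans_lt hfin
  refine (lintegral_mono (hle x)).trans_eq ?_
  rw [lintegral_indicator measurableSet_Icc,
    lintegral_mul_const _ (hw.of_uncurry_right.enorm.pow_const a)]

theorem memLp_indicator_integral_shift (hp : Measurable (Function.uncurry p)) {a : ℝ} (ha : 0 < a)
    {t : ℝ} (hfin : ∫⁻ x, occupationDensity p t x ^ a ∂μ < ⊤) :
    MemLp (fun q : ℝ × X =>
      (Set.Icc 0 t).indicator (fun r => ∫ u in r..t, p (u - r) q.2) q.1)
      (ENNReal.ofReal a) (volume.prod μ) := by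
  have h := memLp_indicator_mul_integral_shift (μ := μ) (w := fun _ _ => 1) (t := t) hp
    measurable_const ha
  simp only [one_mul, enorm_one, ENNReal.one_rpow, setLIntegral_one] at h
  refine h ?_
  rw [lintegral_const_mul _ ((measurable_occupationDensity hp t).pow_const a)]
  exact ENNReal.mul_lt_top measure_Icc_lt_top hfin

theorem memLp_indicator_rpow_mul_integral_shift (hp : Measurable (Function.uncurry p)) {a : ℝ}
    (ha : 0 < a) {t : ℝ} (hfin : ∫⁻ x, occupationDensity p t x ^ (1 + a) ∂μ < ⊤) :
    MemLp (fun q : ℝ × X =>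
      (Set.Icc 0 t).indicator (fun r => p r q.2 ^ (1 / a) * ∫ u in r..t, p (u - r) q.2) q.1)
      (ENNReal.ofReal a) (volume.prod μ) := by
  refine memLp_indicator_mul_integral_shift (w := fun r x => p r x ^ (1 / a)) hp
    (hp.pow_const _) ha (lt_of_le_of_lt (lintegral_mono fun x => ?_) hfin)
  have hweight (r : ℝ) : ‖p r x ^ (1 / a)‖ₑ ^ a ≤ ‖p r x‖ₑ := by
    rw [Real.enorm_eq_ofReal_abs, Real.enorm_eq_ofReal_abs,
      ENNReal.ofReal_rpow_of_nonneg (abs_nonneg _) ha.le]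
    refine ENNReal.ofReal_le_ofReal ?_
    calc |p r x ^ (1 / a)| ^ a ≤ (|p r x| ^ (1 / a)) ^ a := by
          gcongr
          exact Real.abs_rpow_le_abs_rpow _ _
      _ = |p r x| := by
          rw [← Real.rpow_mul (abs_nonneg _), one_div_mul_cancel ha.ne', Real.rpow_one]
  rw [ENNReal.rpow_add_of_nonneg _ _ zero_le_one ha.le, ENNReal.rpow_one]
  gcongr
  rw [occupationDensity, Measure.restrict_congr_set Ioc_ae_eq_Icc]
  exact lintegral_mono hweight

theorem ae_intervalIntegrable_shift (hp : Measurable (Function.uncurry p))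
    (hp1 : ∀ u, 0 < u → ∫⁻ x, ‖p u x‖ₑ ∂μ ≤ 1) (t : ℝ) :
    ∀ᵐ q ∂((volume : Measure ℝ).prod μ), q.1 ∈ Set.Icc 0 t →
      IntervalIntegrable (fun u => p (u - q.1) q.2) volume q.1 t := by
  have hfin : ∀ᵐ x ∂μ, occupationDensity p t x < ⊤ :=
    ae_lt_top (measurable_occupationDensity hp t)
      ((lintegral_occupationDensity_le hp hp1 t).trans_lt ENNReal.ofReal_lt_top).ne
  filter_upwards [Measure.quasiMeasurePreserving_snd.ae hfin] with q hq hqt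
  have hint : IntegrableOn (fun u => p u q.2) (Set.Ioc 0 t) :=
    ⟨hp.of_uncurry_right.aestronglyMeasurable, hq⟩
  have hshift : IntervalIntegrable (fun u => p u q.2) volume 0 (t - q.1) := by
    rw [intervalIntegrable_iff_integrableOn_Ioc_of_le (sub_nonneg.2 hqt.2)]
    exact hint.mono_set (Set.Ioc_subset_Ioc_right (sub_le_self t hqt.1))
  simpa only [zero_add, sub_add_cancel] using hshift.comp_sub_right q.1

end TimeShiftedKernel

end

theorem proposition2p1 {Ω : Type*} [MeasurableSpace Ω] (P : Measure Ω) [IsProbabilityMeasure P]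
    (d : ℕ) (hd : 1 ≤ d) (α β : ℝ) (hα0 : 0 < α) (hα2 : α ≤ 2) (hβ0 : 0 < β) (hβ1 : β ≤ 1)
    (M : Set (ℝ × EuclideanSpace ℝ (Fin d)) → Ω → ℝ)
    (hM : IsStableRandomMeasure P volume (1 + β) M) :
    ((d : ℝ) < α * (1 + β) / β →
      (∀ t : ℝ, 0 ≤ t → ∀ᵐ q : ℝ × EuclideanSpace ℝ (Fin d), q.1 ∈ Set.Icc 0 t →
        IntervalIntegrable (fun u => stableDensity d α (u - q.1) q.2) volume q.1 t) ∧
      StableIntegralProcessWellDefined P volume (1 + β) M (fun t => xiKernel d α t)) ∧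
    ((d : ℝ) < α * (2 + β) / (1 + β) →
      (∀ t : ℝ, 0 ≤ t → ∀ᵐ q : ℝ × EuclideanSpace ℝ (Fin d), q.1 ∈ Set.Icc 0 t →
        0 ≤ stableDensity d α q.1 q.2 ∧
        IntervalIntegrable (fun u => stableDensity d α (u - q.1) q.2) volume q.1 t) ∧
      StableIntegralProcessWellDefined P volume (1 + β) M (fun t => zetaKernel d α β t)) := by
  have hm := measurable_stableDensity d α
  have hle := fun u (hu : 0 < u) => abs_stableDensity_le (d := d) hα0 hu
  have hp1 := fun u (hu : 0 < u) => lintegral_enorm_stableDensity_le_one (d := d) hα0 hα2 hu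
  have hint := fun t => ae_intervalIntegrable_shift hm hp1 t
  have ha : 0 < 1 + β := by positivity
  refine ⟨fun hdim => ⟨fun t _ => hint t, ?_⟩, fun hdim => ⟨fun t _ => ?_, ?_⟩⟩
  · refine stableIntegralProcessWellDefined_of_memLp ha hM fun t _ =>
      memLp_indicator_integral_shift hm ha
        (lintegral_occupationDensity_rpow_lt_top hm hle hp1 (by linarith) ?_ t)
    rw [lt_div_iff₀ hβ0] at hdim
    rw [add_sub_cancel_left, div_mul_eq_mul_div, div_lt_iff₀ hα0]
    linarith
  · filter_upwards [hint t, ae_fst_ne_zero] with q hq hq0 hqt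
    exact ⟨stableDensity_nonneg hα0 hα2 (hqt.1.lt_of_ne' hq0) q.2, hq hqt⟩
  · refine stableIntegralProcessWellDefined_of_memLp ha hM fun t _ =>
      memLp_indicator_rpow_mul_integral_shift hm ha
        (lintegral_occupationDensity_rpow_lt_top hm hle hp1 (by linarith) ?_ t)
    rw [lt_div_iff₀ ha] at hdim
    rw [add_sub_cancel_left, div_mul_eq_mul_div, div_lt_iff₀ hα0]
    linarith
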